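/- Let $n\ge 1$ and $N\ge 1$ be integers and let $\alpha>-1$ be real. Let $\mathbb B$ be the open unit ball of $\mathbb C^n$ with $\langle z,w\rangle=\sum_i z_i\overline{w_i}$, let $v$ be the volume measure normalized by $v(\mathbb B)=1$, and let $dv_\alpha(z)=c_\alpha(1-|z|^2)^\alpha\,dv(z)$, with $c_\alpha$ chosen so that $v_\alpha(\mathbb B)=1$. For $g\in L^\infty(\mathbb B)$ let $$P_\alpha g(z)=\int_{\mathbb B}\frac{g(w)}{(1-\langle z,w\rangle)^{n+1+\alpha}}\,dv_\alpha(w),\qquad z\in\mathbb B,$$ be its weighted Bergman projection. The Bloch space $\mathcal B$ consists of the holomorphic functions $f$ on $\mathbb B$ with $\sup_{z\in\mathbb B}(1-|z|^2)|\nabla f(z)|<\infty$, where $\nabla f=(\partial f/\partial z_1,\dots,\partial f/\partial z_n)$, and it is given the norm $$\|f\|_{\mathcal B}=\max_{|m|\le N-1}\left|\frac{\partial^{|m|}f}{\partial z^m}(0)\right|+\max_{|m|=N}\ \sup_{z\in\mathbb B}\,(1-|z|^2)^N\left|\frac{\partial^N f}{\partial z^m}(z)\right|,$$ where $m$ runs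 over multi-indices in $\mathbb N_0^n$ and $|m|=m_1+\dots+m_n$. Then $P_\alpha$ maps $L^\infty(\mathbb B)$ into $\mathcal B$, and its norm $\|P_\alpha\|_{\mathcal B}=\sup_{\|g\|_\infty\le 1}\|P_\alpha g\|_{\mathcal B}$ is $$\|P_\alpha\|_{\mathcal B}=\frac{\Gamma(n+N+\alpha)\,\Gamma\!\left(\frac{1+N}{2}\right)}{\Gamma\!\left(\frac{1+N}{2}+\alpha+n\right)}+\frac{\Gamma(n+N+\alpha+1)\,\Gamma(N)}{\Gamma\!\left(\frac N2+\frac{n+\alpha+1}{2}\right)^2}.$$ -/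

import Mathlib

open MeasureTheory Metric
open scoped ENNReal

noncomputable section

namespace BergmanBloch

/-- Complex `n`-space with the Euclidean norm. -/
abbrev Cn (n : ℕ) := EuclideanSpace ℂ (Fin n)

/-- The open unit ball of complex `n`-space. -/
def unitBall (n : ℕ) : Set (Cn n) := ball 0 1

/-- The volume measure `v` on the unit ball, normalized so that `v(𝔹) = 1`. -/
def ballMeasure (n : ℕ) : Measure (Cn n) :=
  (volume (unitBall n))⁻¹ • volume.restrict (unitBall n)

/-- The constant `c_α`, determined by the condition `c_α ∫ (1 - |z|²)^α dv(z) = 1`. -/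
def weightConst (n : ℕ) (α : ℝ) : ℝ≥0∞ :=
  (∫⁻ z, ENNReal.ofReal ((1 - ‖z‖ ^ 2) ^ α) ∂ballMeasure n)⁻¹

/-- The weighted measure `dv_α(z) = c_α (1 - |z|²)^α dv(z)` on the unit ball. -/
def weightedMeasure (n : ℕ) (α : ℝ) : Measure (Cn n) :=
  weightConst n α • (ballMeasure n).withDensity fun z => ENNReal.ofReal ((1 - ‖z‖ ^ 2) ^ α)

/-- The weighted Bergman kernel `1 / (1 - ⟨z, w⟩)^(n + 1 + α)` (principal branch of the power),
where `⟨z, w⟩ = ∑ i, z i * conj (w i)`, which Mathlib writes `inner ℂ w z`. -/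
def bergmanKernel (n : ℕ) (α : ℝ) (z w : Cn n) : ℂ :=
  1 / (1 - inner ℂ w z) ^ ((n : ℂ) + 1 + (α : ℂ))

/-- The space `L^∞(𝔹)`. -/
abbrev LInfty (n : ℕ) := Lp ℂ ∞ (ballMeasure n)

/-- The Bergman projection of `g ∈ L^∞(𝔹)`; only its values on the unit ball are meaningful. -/
def bergmanProj (n : ℕ) (α : ℝ) (g : LInfty n) (z : Cn n) : ℂ :=
  ∫ w, bergmanKernel n α z w * g w ∂weightedMeasure n α

/-- The complex partial derivative `∂f/∂z_i`. -/
def partialDeriv {n : ℕ} (i : Fin n) (f : Cn n → ℂ) (z : Cn n) : ℂ :=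
  lineDeriv ℂ f z (EuclideanSpace.single i 1)

/-- The partial derivative `∂^|m| f / ∂z^m` for a multi-index `m`: each `∂/∂z_i` is applied
`m i` times. -/
def multiDeriv {n : ℕ} (m : Fin n → ℕ) (f : Cn n → ℂ) : Cn n → ℂ :=
  (List.finRange n).foldr (fun i F => (partialDeriv i)^[m i] F) f

/-- Membership in the Bloch space: `f` is holomorphic on the unit ball and
`sup_{z ∈ 𝔹} (1 - |z|²) |∇f(z)|` is finite, `∇f = (∂f/∂z_1, …, ∂f/∂z_n)`. -/
def IsBloch {n : ℕ} (f : Cn n → ℂ) : Prop :=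
  DifferentiableOn ℂ f (unitBall n) ∧
    ∃ C : ℝ, ∀ z ∈ unitBall n,
      (1 - ‖z‖ ^ 2) * ‖(WithLp.toLp 2 fun i => partialDeriv i f z : Cn n)‖ ≤ C

/-- The seminorm `max_{|m| = N} sup_{z ∈ 𝔹} (1 - |z|²)^N |∂^N f / ∂z^m (z)|`. -/
def blochSeminorm {n : ℕ} (N : ℕ) (f : Cn n → ℂ) : ℝ≥0∞ :=
  ⨆ (m : Fin n → ℕ) (_ : ∑ i, m i = N) (z : Cn n) (_ : z ∈ unitBall n),
    ENNReal.ofReal ((1 - ‖z‖ ^ 2) ^ N * ‖multiDeriv m f z‖)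

/-- The Bloch norm `max_{|m| ≤ N - 1} |∂^|m| f / ∂z^m (0)|` plus the seminorm of order `N`. -/
def blochNorm {n : ℕ} (N : ℕ) (f : Cn n → ℂ) : ℝ≥0∞ :=
  (⨆ (m : Fin n → ℕ) (_ : ∑ i, m i ≤ N - 1), ENNReal.ofReal ‖multiDeriv m f 0‖) +
    blochSeminorm N f

/-- The norm of the Bergman projection from `L^∞(𝔹)` to the Bloch space with `blochNorm N`:
the supremum of the Bloch norms of the images of the unit ball of `L^∞(𝔹)`. -/
def bergmanProjNorm (n N : ℕ) (α : ℝ) : ℝ≥0∞ :=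
  ⨆ (g : LInfty n) (_ : ‖g‖ ≤ 1), blochNorm N (bergmanProj n α g)

end BergmanBloch

end

namespace BergmanBloch

open Filter Topology ComplexConjugate

/-! Put `x = n + 1 + α`. Differentiating the kernel gives, for `|m| = k`, `∂^m P_α g(z) =
Γ(x+k)/Γ(x) ∫ g(w) conj(w)^m (1 - ⟨z,w⟩)^(-(x+k)) dv_α(w)` (`multiDeriv_bergmanProj`), so the
problem is about L¹ norms of these kernels. Unitary invariance and integrating out all coordinates
but one turn the relevant integrals into integrals over the disc against the probability measure
proportional to `(1 - |ζ|²)^(x-2)`.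

Upper bound. At the origin, AM-GM reduces `∏ |w_i|^(m_i)` to the pure power `|w_i|^k`, whose moment
is a Beta integral; the resulting constant increases with `k` (`momentConst_mono`, by log-convexity
of Gamma), so `k = N - 1` dominates. For the seminorm, `|w^m| ≤ 1` leaves `(1 - r²)^N ∫ |1 -
rζ|^(-(x+N))`. A disc automorphism turns this into `∫ |1 - rω|^(N-x)`, which increases with `r` by
Parseval applied to the holomorphic function `(1 - rω)^((N-x)/2)`; its limit at `r = 1` is computed
in the half-plane after a Cayley transform. This is `lintegral_forelliRudin_le`.

Lower bound. A single `g` must nearly attain both terms. Let `K` be the kernel of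
`∂^(N-1)/∂z_1^(N-1)` at `0` plus `(1 - r²)^N` times the kernel of `∂^N/∂z_1^N` at `r e_1`, and let
`g` be the conjugate phase of `K`; then the L¹ norm of `K` is at most the operator norm. As `r → 1`
the second summand tends to `0` pointwise in the ball while its L¹ norm tends to the sharp seminorm
constant, so the two summands become asymptotically disjoint and their L¹ norms add
(`le_bergmanProjNorm`). -/

/-! ### Slicing the weighted volume of the ball -/

/-- The radial weight `(1 - ∑ |w i|²)^α` on the unit ball of `Fin n → ℂ`, extended by zero. -/
noncomputable def ballWeight (n : ℕ) (α : ℝ) (w : Fin n → ℂ) : ℝ≥0∞ :=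
  if ∑ i, ‖w i‖ ^ 2 < 1 then ENNReal.ofReal ((1 - ∑ i, ‖w i‖ ^ 2) ^ α) else 0

/-- The radial weight `(1 - |ζ|²)^β` on the unit disc, extended by zero. -/
noncomputable def discWeight (β : ℝ) (ζ : ℂ) : ℝ≥0∞ :=
  if ‖ζ‖ < 1 then ENNReal.ofReal ((1 - ‖ζ‖ ^ 2) ^ β) else 0

/-- The total mass of `ballWeight`. -/
noncomputable def ballMass (n : ℕ) (α : ℝ) : ℝ≥0∞ := ∫⁻ w, ballWeight n α w

theorem measurable_ballWeight (n : ℕ) (α : ℝ) : Measurable (ballWeight n α) := by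
  unfold ballWeight
  refine Measurable.ite (measurableSet_lt (by fun_prop) (by fun_prop)) (by fun_prop) (by fun_prop)

theorem measurable_discWeight (β : ℝ) : Measurable (discWeight β) := by
  unfold discWeight
  refine Measurable.ite (measurableSet_lt (by fun_prop) (by fun_prop)) (by fun_prop) (by fun_prop)

theorem lintegral_comp_real_smul {n : ℕ} {R : ℝ} (hR : 0 < R) (f : (Fin n → ℂ) → ℝ≥0∞)
    (hf : Measurable f) :
    ∫⁻ w, f w = ENNReal.ofReal ((R ^ 2) ^ n) * ∫⁻ w, f (R • w) := by
  have h := Measure.map_addHaar_smul (volume : Measure (Fin n → ℂ)) hR.ne'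
  have hd : Module.finrank ℝ (Fin n → ℂ) = n * 2 := by
    rw [Module.finrank_pi_fintype]; simp
  rw [← lintegral_map hf (measurable_const_smul R), h, lintegral_smul_measure, hd, smul_eq_mul,
    ← mul_assoc, ← ENNReal.ofReal_mul (by positivity), abs_of_pos (by positivity)]
  rw [show (R ^ 2) ^ n * (R ^ (n * 2))⁻¹ = 1 by rw [← pow_mul, mul_comm 2 n]; field_simp]
  simp

/-- Rescaling by `√s` contributes `s^n` from the real dimension `2n` and `s^α` from the weight.
Applied with `s = 1 - |ζ|²`, this raises the exponent of the one-coordinate weight from `α` to `α +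
n`. -/
theorem lintegral_fiber_ballWeight {n : ℕ} {α s : ℝ} (hs : 0 < s) :
    ∫⁻ w : Fin n → ℂ, (if ∑ i, ‖w i‖ ^ 2 < s then
      ENNReal.ofReal ((s - ∑ i, ‖w i‖ ^ 2) ^ α) else 0) =
      ENNReal.ofReal (s ^ (α + n)) * ballMass n α := by
  have hR : 0 < √s := Real.sqrt_pos.2 hs
  have hsq : √s ^ 2 = s := Real.sq_sqrt hs.le
  rw [lintegral_comp_real_smul hR, hsq, ballMass, Real.rpow_add hs, Real.rpow_natCast, mul_comm (s ^ α),
    ENNReal.ofReal_mul (by positivity), mul_assoc]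
  · congr 1
    rw [← lintegral_const_mul _ (measurable_ballWeight n α)]
    refine lintegral_congr fun w => ?_
    have hsum : ∑ i, ‖(√s • w) i‖ ^ 2 = s * ∑ i, ‖w i‖ ^ 2 := by
      rw [Finset.mul_sum]
      refine Finset.sum_congr rfl fun i _ => ?_
      rw [Pi.smul_apply, norm_smul, mul_pow, Real.norm_of_nonneg hR.le, hsq]
    rw [hsum, ballWeight]
    have hiff : s * ∑ i, ‖w i‖ ^ 2 < s ↔ ∑ i, ‖w i‖ ^ 2 < 1 := by
      constructor <;> intro h <;> nlinarith
    by_cases h : ∑ i, ‖w i‖ ^ 2 < 1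
    · rw [if_pos (hiff.2 h), if_pos h, ← ENNReal.ofReal_mul (by positivity),
        ← Real.mul_rpow hs.le (by linarith)]
      ring_nf
    · rw [if_neg (fun h' => h (hiff.1 h')), if_neg h, mul_zero]
  · exact Measurable.ite (measurableSet_lt (by fun_prop) (by fun_prop)) (by fun_prop) (by fun_prop)

/-- Integrating out all coordinates but one against `ballWeight`. -/
theorem lintegral_coord_ballWeight {n : ℕ} (α : ℝ) (i : Fin (n + 1)) {F : ℂ → ℝ≥0∞}
    (hF : Measurable F) :
    ∫⁻ w : Fin (n + 1) → ℂ, F (w i) * ballWeight (n + 1) α w =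
      ballMass n α * ∫⁻ ζ, F ζ * discWeight (α + n) ζ := by
  have hmp := volume_preserving_piFinSuccAbove (fun _ : Fin (n + 1) => ℂ) i
  have hm : Measurable fun w : Fin (n + 1) → ℂ => F (w i) * ballWeight (n + 1) α w :=
    (hF.comp (measurable_pi_apply i)).mul (measurable_ballWeight _ _)
  rw [← hmp.symm.lintegral_comp hm, Measure.volume_eq_prod, lintegral_prod _
    (by exact (hm.comp (MeasurableEquiv.measurable _)).aemeasurable), ← lintegral_const_mul _
    (show Measurable fun ζ => F ζ * discWeight (α + n) ζ from hF.mul (measurable_discWeight _))]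
  refine lintegral_congr fun ζ => ?_
  have hsymm : ∀ w : Fin n → ℂ,
      (MeasurableEquiv.piFinSuccAbove (fun _ : Fin (n + 1) => ℂ) i).symm (ζ, w) =
        (i.insertNth ζ w : Fin (n + 1) → ℂ) := fun _ => rfl
  have key : ∀ w : Fin n → ℂ, ballWeight (n + 1) α
      ((MeasurableEquiv.piFinSuccAbove (fun _ : Fin (n + 1) => ℂ) i).symm (ζ, w)) =
      if ∑ j, ‖w j‖ ^ 2 < 1 - ‖ζ‖ ^ 2 then
        ENNReal.ofReal ((1 - ‖ζ‖ ^ 2 - ∑ j, ‖w j‖ ^ 2) ^ α) else 0 := by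
    intro w
    have hsum : ∑ j, ‖((MeasurableEquiv.piFinSuccAbove (fun _ : Fin (n + 1) => ℂ) i).symm
        (ζ, w)) j‖ ^ 2 = ‖ζ‖ ^ 2 + ∑ j, ‖w j‖ ^ 2 := by
      rw [hsymm, Fin.sum_univ_succAbove _ i]
      simp
    rw [ballWeight, hsum]
    simp only [lt_sub_iff_add_lt', sub_sub]
  have hi : ∀ w : Fin n → ℂ, ((MeasurableEquiv.piFinSuccAbove (fun _ : Fin (n + 1) => ℂ) i).symm
      (ζ, w)) i = ζ := by
    intro w; rw [hsymm, Fin.insertNth_apply_same]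
  simp only [key, hi]
  rw [lintegral_const_mul _ (Measurable.ite (measurableSet_lt (by fun_prop) (by fun_prop))
    (by fun_prop) (by fun_prop)), discWeight]
  by_cases h : ‖ζ‖ < 1
  · rw [lintegral_fiber_ballWeight (by nlinarith [norm_nonneg ζ]), if_pos h]
    ring
  · have : ∀ w : Fin n → ℂ, ¬ ∑ j, ‖w j‖ ^ 2 < 1 - ‖ζ‖ ^ 2 := by
      intro w h'
      have : 0 ≤ ∑ j, ‖w j‖ ^ 2 := by positivity
      nlinarith [norm_nonneg ζ]
    simp [this, h]


/-! ### Radial integrals on the disc and the Beta function -/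

/-- Polar coordinates with `t = ρ²`: the factor `ρ dρ` is `dt / 2`, and the angle contributes `2π`.
-/
theorem lintegral_comp_norm_sq {F : ℝ → ℝ≥0∞} (hF : Measurable F) :
    ∫⁻ ζ : ℂ, F (‖ζ‖ ^ 2) = ENNReal.ofReal Real.pi * ∫⁻ t in Set.Ioi 0, F t := by
  have himg : (fun ρ : ℝ => ρ ^ 2) '' Set.Ioi 0 = Set.Ioi 0 := by
    ext t
    constructor
    · rintro ⟨ρ, hρ, rfl⟩
      exact pow_pos (Set.mem_Ioi.1 hρ) 2
    · intro ht
      exact ⟨√t, Real.sqrt_pos.2 ht, Real.sq_sqrt (Set.mem_Ioi.1 ht).le⟩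
  have hcv := lintegral_image_eq_lintegral_abs_deriv_mul (s := Set.Ioi (0 : ℝ))
    (f := fun ρ : ℝ => ρ ^ 2) (f' := fun ρ => 2 * ρ) measurableSet_Ioi
    (fun ρ _ => by simpa using (hasDerivAt_pow 2 ρ).hasDerivWithinAt)
    (fun a ha b hb hab => by
      exact (pow_left_inj₀ (Set.mem_Ioi.1 ha).le (Set.mem_Ioi.1 hb).le two_ne_zero).1 hab) F
  rw [himg] at hcv
  have hm : Measurable fun p : ℝ × ℝ => ENNReal.ofReal p.1 * F (p.1 ^ 2) := by fun_prop
  rw [hcv, ← Complex.lintegral_comp_polarCoord_symm]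
  simp only [Complex.norm_polarCoord_symm, sq_abs, smul_eq_mul]
  rw [polarCoord_target, Measure.volume_eq_prod,
    ← Measure.prod_restrict, lintegral_prod _ hm.aemeasurable,
    ← lintegral_const_mul _ (by fun_prop)]
  refine setLIntegral_congr_fun measurableSet_Ioi fun ρ hρ => ?_
  have hρ' : 0 < ρ := hρ
  simp only [lintegral_const, Measure.restrict_apply MeasurableSet.univ, Set.univ_inter,
    Real.volume_Ioo]
  rw [abs_of_pos (by positivity), ENNReal.ofReal_mul zero_le_two,
    show Real.pi - -Real.pi = Real.pi * 2 by ring, ENNReal.ofReal_mul Real.pi_pos.le]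
  ring

/-- The Beta integral as a lower Lebesgue integral. -/
theorem lintegral_rpow_mul_one_sub_rpow {a b : ℝ} (ha : 0 < a) (hb : 0 < b) :
    ∫⁻ t in Set.Ioo (0 : ℝ) 1, ENNReal.ofReal (t ^ (a - 1) * (1 - t) ^ (b - 1)) =
      ENNReal.ofReal (Real.Gamma a * Real.Gamma b / Real.Gamma (a + b)) := by
  have h := ProbabilityTheory.lintegral_betaPDF_eq_one ha hb
  have hB := ProbabilityTheory.beta_pos ha hb
  rw [ProbabilityTheory.lintegral_betaPDF] at h
  simp only [mul_assoc] at h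
  simp_rw [ENNReal.ofReal_mul (one_div_pos.2 hB).le] at h
  rw [lintegral_const_mul _ (by fun_prop)] at h
  have hmul : ENNReal.ofReal (ProbabilityTheory.beta a b) *
      ENNReal.ofReal (1 / ProbabilityTheory.beta a b) = 1 := by
    rw [← ENNReal.ofReal_mul hB.le, mul_one_div_cancel hB.ne', ENNReal.ofReal_one]
  rw [← ProbabilityTheory.beta, ← mul_one (ENNReal.ofReal (ProbabilityTheory.beta a b)), ← h,
    ← mul_assoc, hmul, one_mul]

theorem lintegral_norm_rpow_mul_discWeight {β k : ℝ} (hβ : -1 < β) (hk : 0 ≤ k) :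
    ∫⁻ ζ : ℂ, ENNReal.ofReal (‖ζ‖ ^ k) * discWeight β ζ =
      ENNReal.ofReal (Real.pi *
        (Real.Gamma (k / 2 + 1) * Real.Gamma (β + 1) / Real.Gamma (k / 2 + 1 + (β + 1)))) := by
  have hF : Measurable fun t : ℝ => if t < 1 then ENNReal.ofReal (t ^ (k / 2) * (1 - t) ^ β)
      else 0 := Measurable.ite measurableSet_Iio (by fun_prop) (by fun_prop)
  have h := lintegral_comp_norm_sq hF
  have h1 : ∀ ζ : ℂ, ENNReal.ofReal (‖ζ‖ ^ k) * discWeight β ζ =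
      if ‖ζ‖ ^ 2 < 1 then ENNReal.ofReal ((‖ζ‖ ^ 2) ^ (k / 2) * (1 - ‖ζ‖ ^ 2) ^ β) else 0 := by
    intro ζ
    have hiff : ‖ζ‖ ^ 2 < 1 ↔ ‖ζ‖ < 1 := by
      rw [sq_lt_one_iff₀ (norm_nonneg ζ)]
    rw [discWeight]
    by_cases hζ : ‖ζ‖ < 1
    · rw [if_pos hζ, if_pos (hiff.2 hζ), ← ENNReal.ofReal_mul (by positivity), ← Real.rpow_natCast,
        ← Real.rpow_mul (norm_nonneg ζ)]
      congr 4
      push_cast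
      ring
    · rw [if_neg hζ, if_neg (fun h' => hζ (hiff.1 h')), mul_zero]
  simp_rw [h1]
  rw [h, ENNReal.ofReal_mul Real.pi_pos.le, ← lintegral_rpow_mul_one_sub_rpow (by linarith)
    (by linarith), ← lintegral_indicator measurableSet_Ioi, ← lintegral_indicator measurableSet_Ioo]
  congr 1
  refine lintegral_congr fun t => ?_
  by_cases h0 : 0 < t <;> by_cases h2 : t < 1 <;> simp [Set.indicator, h0, h2]

theorem lintegral_discWeight {β : ℝ} (hβ : -1 < β) :
    ∫⁻ ζ, discWeight β ζ = ENNReal.ofReal (Real.pi / (β + 1)) := by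
  have h := lintegral_norm_rpow_mul_discWeight hβ le_rfl
  have hβ' : 0 < β + 1 := by linarith
  have := Real.Gamma_pos_of_pos hβ'
  simp only [Real.rpow_zero, ENNReal.ofReal_one, one_mul, zero_div, zero_add, Real.Gamma_one] at h
  rw [h, add_comm 1 (β + 1), Real.Gamma_add_one hβ'.ne']
  congr 1
  field_simp

/-- Induction on the dimension by slicing off one coordinate. The value of the mass is never needed,
since it cancels in the normalized measure. -/
theorem ballMass_ne_zero_ne_top {α : ℝ} (hα : -1 < α) (n : ℕ) :
    ballMass n α ≠ 0 ∧ ballMass n α ≠ ∞ := by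
  induction n with
  | zero =>
    have : ballMass 0 α = 1 := by simp [ballMass, ballWeight, lintegral_unique, volume_pi]
    simp [this]
  | succ n ih =>
    have h := lintegral_coord_ballWeight (n := n) α 0 (F := fun _ => 1) measurable_const
    have hαn : -1 < α + n := by have : (0 : ℝ) ≤ n := by positivity
                                linarith
    simp only [one_mul] at h
    rw [lintegral_discWeight hαn] at h
    rw [ballMass, h]
    have : 0 < Real.pi / (α + n + 1) := div_pos Real.pi_pos (by linarith)
    exact ⟨mul_ne_zero ih.1 (by simpa using this), ENNReal.mul_ne_top ih.2 ENNReal.ofReal_ne_top⟩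

/-! ### Normalized measures and the law of one coordinate -/

/-- The probability measure on `ℂ` with density proportional to `discWeight β`. -/
noncomputable def discMeasure (β : ℝ) : Measure ℂ :=
  ENNReal.ofReal ((β + 1) / Real.pi) • volume.withDensity (discWeight β)

theorem lintegral_discMeasure (β : ℝ) (F : ℂ → ℝ≥0∞) (hF : Measurable F) :
    ∫⁻ ζ, F ζ ∂discMeasure β =
      ENNReal.ofReal ((β + 1) / Real.pi) * ∫⁻ ζ, F ζ * discWeight β ζ := by
  rw [discMeasure, lintegral_smul_measure,
    lintegral_withDensity_eq_lintegral_mul _ (measurable_discWeight β) hF, smul_eq_mul]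
  simp [mul_comm]

theorem isProbabilityMeasure_discMeasure {β : ℝ} (hβ : -1 < β) :
    IsProbabilityMeasure (discMeasure β) := by
  constructor
  have hβ' : 0 < β + 1 := by linarith
  have h := lintegral_discMeasure β (fun _ => 1) measurable_const
  simp only [lintegral_one, one_mul] at h
  rw [h, lintegral_discWeight hβ, ← ENNReal.ofReal_mul (by positivity)]
  rw [div_mul_div_cancel₀ Real.pi_ne_zero, div_self hβ'.ne', ENNReal.ofReal_one]

theorem norm_lt_one_iff_sum {n : ℕ} (z : Cn n) : ‖z‖ < 1 ↔ ∑ i, ‖z i‖ ^ 2 < 1 := by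
  rw [← EuclideanSpace.norm_sq_eq, sq_lt_one_iff₀ (norm_nonneg z)]

/-- Uniqueness of Haar measure. The constant is left unspecified because it cancels under
normalization. -/
theorem exists_lintegral_toLp (n : ℕ) : ∃ c : ℝ≥0∞, c ≠ 0 ∧ c ≠ ∞ ∧
    ∀ f : Cn n → ℝ≥0∞, Measurable f →
      ∫⁻ z, f z = c * ∫⁻ w : Fin n → ℂ, f (WithLp.toLp 2 w) := by
  let e : (Fin n → ℂ) ≃L[ℝ] Cn n := (PiLp.continuousLinearEquiv 2 ℝ (fun _ : Fin n => ℂ)).symm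
  have : (Measure.map e (volume : Measure (Fin n → ℂ))).IsAddHaarMeasure :=
    e.isAddHaarMeasure_map _
  have hc := Measure.isAddLeftInvariant_eq_smul (volume : Measure (Cn n))
    (Measure.map e (volume : Measure (Fin n → ℂ)))
  have hc0 := (Measure.addHaarScalarFactor_pos_of_isAddHaarMeasure
    (volume : Measure (Cn n)) (Measure.map e (volume : Measure (Fin n → ℂ)))).ne'
  generalize (volume : Measure (Cn n)).addHaarScalarFactor
    (Measure.map e (volume : Measure (Fin n → ℂ))) = c at hc hc0
  refine ⟨c, ENNReal.coe_ne_zero.2 hc0, ENNReal.coe_ne_top, fun f hf => ?_⟩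
  rw [hc, lintegral_smul_measure, lintegral_map hf e.continuous.measurable]
  rfl

theorem lintegral_ballMeasure (n : ℕ) (f : Cn n → ℝ≥0∞) :
    ∫⁻ z, f z ∂ballMeasure n = (volume (unitBall n))⁻¹ * ∫⁻ z in unitBall n, f z := by
  rw [ballMeasure, lintegral_smul_measure, smul_eq_mul]

theorem lintegral_unitBall_weight (n : ℕ) (α : ℝ) (f : Cn n → ℝ≥0∞) :
    ∫⁻ z in unitBall n, f z * ENNReal.ofReal ((1 - ‖z‖ ^ 2) ^ α) =
      ∫⁻ z : Cn n, f z * ballWeight n α (WithLp.ofLp z) := by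
  rw [unitBall, ← lintegral_indicator measurableSet_ball]
  refine lintegral_congr fun z => ?_
  by_cases h : ‖z‖ < 1
  · rw [Set.indicator_of_mem (by simpa using h), ballWeight, if_pos ((norm_lt_one_iff_sum z).1 h),
      EuclideanSpace.norm_sq_eq]
  · rw [Set.indicator_of_notMem (by simpa using h), ballWeight,
      if_neg (fun h' => h ((norm_lt_one_iff_sum z).2 h')), mul_zero]

theorem measurable_weight (n : ℕ) (α : ℝ) :
    Measurable fun z : Cn n => ENNReal.ofReal ((1 - ‖z‖ ^ 2) ^ α) := by fun_prop

/-- The volume of the ball and the Haar constant occur both in the integral and in the normalizing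
constant, so only the mass in product coordinates survives. -/
theorem lintegral_weightedMeasure {n : ℕ} {α : ℝ} {f : Cn n → ℝ≥0∞}
    (hf : Measurable f) :
    ∫⁻ z, f z ∂weightedMeasure n α =
      (ballMass n α)⁻¹ * ∫⁻ w : Fin n → ℂ, f (WithLp.toLp 2 w) * ballWeight n α w := by
  obtain ⟨c, hc0, hct, hc⟩ := exists_lintegral_toLp n
  have hV0 : volume (unitBall n) ≠ 0 := (measure_ball_pos volume _ one_pos).ne'
  have hVt : volume (unitBall n) ≠ ∞ := measure_ball_lt_top.ne
  have hw : Measurable fun z : Cn n => ballWeight n α (WithLp.ofLp z) :=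
    (measurable_ballWeight n α).comp (PiLp.continuous_ofLp 2 _).measurable
  have h1 : ∀ f : Cn n → ℝ≥0∞, Measurable f →
      ∫⁻ z, f z * ENNReal.ofReal ((1 - ‖z‖ ^ 2) ^ α) ∂ballMeasure n =
      (volume (unitBall n))⁻¹ * c *
        ∫⁻ w : Fin n → ℂ, f (WithLp.toLp 2 w) * ballWeight n α w := by
    intro f hf
    rw [lintegral_ballMeasure, lintegral_unitBall_weight, hc (fun z => f z * ballWeight n α (WithLp.ofLp z)) (hf.mul hw), mul_assoc]
  have hconst : weightConst n α = ((volume (unitBall n))⁻¹ * c)⁻¹ * (ballMass n α)⁻¹ := by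
    have := h1 (fun _ => 1) measurable_const
    simp only [one_mul] at this
    rw [weightConst, this, ENNReal.mul_inv]
    · rfl
    · exact Or.inl (mul_ne_zero (ENNReal.inv_ne_zero.2 hVt) hc0)
    · exact Or.inl (ENNReal.mul_ne_top (ENNReal.inv_ne_top.2 hV0) hct)
  rw [weightedMeasure, lintegral_smul_measure,
    lintegral_withDensity_eq_lintegral_mul _ (measurable_weight n α) hf, smul_eq_mul]
  have h2 := h1 f hf
  simp only [Pi.mul_apply]
  simp_rw [mul_comm _ (f _)]
  rw [h2, hconst, mul_comm _ (ballMass n α)⁻¹, mul_assoc, ← mul_assoc _ ((volume (unitBall n))⁻¹ * c),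
    ENNReal.inv_mul_cancel, one_mul]
  · exact mul_ne_zero (ENNReal.inv_ne_zero.2 hVt) hc0
  · exact ENNReal.mul_ne_top (ENNReal.inv_ne_top.2 hV0) hct

theorem isProbabilityMeasure_weightedMeasure (n : ℕ) {α : ℝ} (hα : -1 < α) :
    IsProbabilityMeasure (weightedMeasure n α) := by
  constructor
  have h := lintegral_weightedMeasure (n := n) (α := α) (f := fun _ => 1) measurable_const
  simp only [lintegral_one, one_mul] at h
  obtain ⟨h0, ht⟩ := ballMass_ne_zero_ne_top hα n
  rw [h, ← ballMass, ENNReal.inv_mul_cancel h0 ht]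

/-- The distribution of one coordinate under `weightedMeasure`. -/
theorem map_coord_weightedMeasure {n : ℕ} {α : ℝ} (hα : -1 < α) (i : Fin n) :
    Measure.map (β := ℂ) (fun w : Cn n => w i) (weightedMeasure n α) = discMeasure (α + n - 1) := by
  -- With `n = k + 1`, the `k` coordinates integrated out raise the exponent to `α + k = α + n - 1`.
  obtain ⟨n, rfl⟩ : ∃ k, n = k + 1 := ⟨n - 1, by have := i.pos; omega⟩
  have hm : Measurable (β := ℂ) fun w : Cn (n + 1) => w i := by fun_prop
  have hαn : 0 < α + n + 1 := by have : (0 : ℝ) ≤ n := by positivity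
                                 linarith
  have hβ : α + (n + 1 : ℕ) - 1 = α + n := by push_cast; ring
  obtain ⟨h0, ht⟩ := ballMass_ne_zero_ne_top hα n
  have hmass : ballMass (n + 1) α = ballMass n α * ENNReal.ofReal (Real.pi / (α + n + 1)) := by
    have h := lintegral_coord_ballWeight (n := n) α 0 (F := fun _ => 1) measurable_const
    simp only [one_mul] at h
    rw [lintegral_discWeight (by linarith)] at h
    exact h
  refine Measure.ext_of_lintegral _ fun F hF => ?_
  rw [lintegral_map hF hm, lintegral_weightedMeasure (f := fun w => F (w i)) (hF.comp hm), lintegral_discMeasure _ _ hF, hβ]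
  rw [lintegral_coord_ballWeight α i hF, hmass, ENNReal.mul_inv (Or.inl h0) (Or.inl ht), mul_comm (ballMass n α)⁻¹,
    mul_assoc, ← mul_assoc (ballMass n α)⁻¹, ENNReal.inv_mul_cancel h0 ht, one_mul,
    ← ENNReal.ofReal_inv_of_pos (by positivity), inv_div]

theorem weightedMeasure_absolutelyContinuous (n : ℕ) (α : ℝ) :
    weightedMeasure n α ≪ ballMeasure n :=
  (Measure.smul_absolutelyContinuous).trans (withDensity_absolutelyContinuous _ _)

theorem ae_mem_unitBall (n : ℕ) (α : ℝ) : ∀ᵐ z ∂weightedMeasure n α, z ∈ unitBall n := by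
  refine (weightedMeasure_absolutelyContinuous n α).ae_le ?_
  refine (Measure.smul_absolutelyContinuous (c := (volume (unitBall n))⁻¹)).ae_le ?_
  exact ae_restrict_mem measurableSet_ball

/-! ### Change of variables by disc automorphisms -/

/-- Multiplication by `f'`, viewed as a real linear map of the plane, has determinant `|f'|²`. -/
theorem lintegral_image_of_hasDerivAt {s : Set ℂ} (hs : MeasurableSet s) {f f' : ℂ → ℂ}
    (hf : ∀ z ∈ s, HasDerivAt f (f' z) z) (hinj : Set.InjOn f s) (g : ℂ → ℝ≥0∞) :
    ∫⁻ z in f '' s, g z = ∫⁻ z in s, ENNReal.ofReal (‖f' z‖ ^ 2) * g (f z) := by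
  rw [lintegral_image_eq_lintegral_abs_det_fderiv_mul volume hs
    (fun z hz => ((hf z hz).hasFDerivAt.restrictScalars ℝ).hasFDerivWithinAt) hinj]
  refine setLIntegral_congr_fun hs fun z _ => ?_
  simp [ContinuousLinearMap.det, LinearMap.det_restrictScalars, Algebra.norm_complex_eq,
    Complex.normSq_eq_norm_sq]

theorem lintegral_mul_discWeight (β : ℝ) (F : ℂ → ℝ≥0∞) :
    ∫⁻ ζ, F ζ * discWeight β ζ =
      ∫⁻ ζ in ball (0 : ℂ) 1, F ζ * ENNReal.ofReal ((1 - ‖ζ‖ ^ 2) ^ β) := by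
  rw [← lintegral_indicator measurableSet_ball]
  refine lintegral_congr fun ζ => ?_
  by_cases h : ‖ζ‖ < 1 <;> simp [discWeight, Set.indicator, h]

theorem norm_ofReal_mul_lt_one {r : ℝ} {ω : ℂ} (h0 : 0 ≤ r) (h1 : r ≤ 1) (hω : ‖ω‖ < 1) :
    ‖(r : ℂ) * ω‖ < 1 := by
  rw [norm_mul, Complex.norm_real, Real.norm_of_nonneg h0]
  nlinarith [norm_nonneg ω]

theorem one_sub_ne_zero_of_norm_lt {u : ℂ} (h : ‖u‖ < 1) : 1 - u ≠ 0 := by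
  intro h'
  rw [← sub_eq_zero.1 h'] at h
  simp at h

/-- The involutive automorphism of the disc exchanging `0` and `r`. -/
noncomputable def moebius (r : ℝ) (ω : ℂ) : ℂ := (r - ω) / (1 - r * ω)

theorem one_sub_norm_moebius_sq {r : ℝ} {ω : ℂ} (hne : 1 - (r : ℂ) * ω ≠ 0) :
    1 - ‖moebius r ω‖ ^ 2 = (1 - r ^ 2) * (1 - ‖ω‖ ^ 2) / ‖1 - (r : ℂ) * ω‖ ^ 2 := by
  have h : ‖1 - (r : ℂ) * ω‖ ^ 2 ≠ 0 := by positivity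
  rw [moebius, norm_div, div_pow, eq_div_iff h, sub_mul, div_mul_cancel₀ _ h, one_mul]
  simp only [Complex.sq_norm, Complex.normSq_apply]
  simp
  ring

theorem one_sub_mul_moebius {r : ℝ} {ω : ℂ} (hne : 1 - (r : ℂ) * ω ≠ 0) :
    1 - (r : ℂ) * moebius r ω = (1 - (r : ℂ) ^ 2) / (1 - r * ω) := by
  rw [moebius]
  field_simp
  ring

theorem moebius_moebius {r : ℝ} (h0 : 0 ≤ r) (h1 : r < 1) {ω : ℂ} (hω : ‖ω‖ < 1) :
    moebius r (moebius r ω) = ω := by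
  have hne := one_sub_ne_zero_of_norm_lt (norm_ofReal_mul_lt_one h0 h1.le hω)
  have hr : (1 - (r : ℂ) ^ 2) ≠ 0 := by
    have : (1 - r ^ 2 : ℝ) ≠ 0 := by nlinarith
    exact_mod_cast this
  have h2 := one_sub_mul_moebius hne
  rw [moebius, h2, moebius]
  field_simp
  ring

theorem norm_moebius_lt_one {r : ℝ} (h0 : 0 ≤ r) (h1 : r < 1) {ω : ℂ} (hω : ‖ω‖ < 1) :
    ‖moebius r ω‖ < 1 := by
  have hne := one_sub_ne_zero_of_norm_lt (norm_ofReal_mul_lt_one h0 h1.le hω)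
  have h := one_sub_norm_moebius_sq hne
  have h2 : 0 < (1 - r ^ 2) * (1 - ‖ω‖ ^ 2) / ‖1 - (r : ℂ) * ω‖ ^ 2 := by
    have h3 : 0 < 1 - r ^ 2 := by nlinarith
    have h4 : 0 < 1 - ‖ω‖ ^ 2 := by nlinarith [norm_nonneg ω]
    positivity
  rw [← sq_lt_one_iff₀ (norm_nonneg _)]
  linarith

theorem moebius_image_ball {r : ℝ} (h0 : 0 ≤ r) (h1 : r < 1) :
    moebius r '' ball (0 : ℂ) 1 = ball 0 1 := by
  ext ω
  simp only [Set.mem_image, mem_ball_zero_iff]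
  constructor
  · rintro ⟨z, hz, rfl⟩
    exact norm_moebius_lt_one h0 h1 hz
  · intro hω
    exact ⟨_, norm_moebius_lt_one h0 h1 hω, moebius_moebius h0 h1 hω⟩

theorem hasDerivAt_moebius {r : ℝ} {ω : ℂ} (hne : 1 - (r : ℂ) * ω ≠ 0) :
    HasDerivAt (moebius r) (-(1 - (r : ℂ) ^ 2) / (1 - r * ω) ^ 2) ω := by
  have h1 : HasDerivAt (fun ω : ℂ => (r : ℂ) - ω) (-1) ω := by
    simpa using (hasDerivAt_id ω).const_sub (r : ℂ)
  have h2 : HasDerivAt (fun ω : ℂ => 1 - (r : ℂ) * ω) (-(r : ℂ)) ω := by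
    simpa using ((hasDerivAt_id ω).const_mul (r : ℂ)).const_sub 1
  convert! h1.div h2 hne using 1
  ring

theorem exists_eq_exp {x : ℝ} (hx : 0 < x) : ∃ a, x = Real.exp a := ⟨Real.log x, (Real.exp_log hx).symm⟩

/-- Here `A = 1 - r²`, `D = |1 - rω|`, `E = 1 - |ω|²`. The factors on the left are the Jacobian, `|1
- rζ| = A/D` and `1 - |ζ|² = AE/D²` at `ζ = moebius r ω`. Writing the three positive numbers as
exponentials reduces the claim to a linear identity of exponents. -/
theorem moebius_weight_identity {A D E : ℝ} (hA : 0 < A) (hD : 0 < D) (hE : 0 < E) (β ν : ℝ) :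
    (A / D ^ 2) ^ 2 * ((A / D) ^ (-(β + 2 + ν)) * (A * E / D ^ 2) ^ β) =
      A ^ (-ν) * (D ^ (ν - (β + 2)) * E ^ β) := by
  obtain ⟨a, rfl⟩ := exists_eq_exp hA
  obtain ⟨d, rfl⟩ := exists_eq_exp hD
  obtain ⟨e, rfl⟩ := exists_eq_exp hE
  simp only [← Real.exp_nat_mul, ← Real.exp_sub, ← Real.exp_add, ← Real.exp_mul]
  congr 1
  push_cast
  ring

/-- The automorphism `moebius r` transforms `|1 - rζ|^(-(β+2+ν))` into `|1 - rω|^(ν-(β+2))`. -/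
theorem lintegral_moebius {r β ν : ℝ} (h0 : 0 ≤ r) (h1 : r < 1) (H : ℂ → ℝ≥0∞) :
    ∫⁻ ζ, H ζ * ENNReal.ofReal (‖1 - (r : ℂ) * ζ‖ ^ (-(β + 2 + ν))) * discWeight β ζ =
      ENNReal.ofReal ((1 - r ^ 2) ^ (-ν)) *
        ∫⁻ ω, H (moebius r ω) * ENNReal.ofReal (‖1 - (r : ℂ) * ω‖ ^ (ν - (β + 2))) *
          discWeight β ω := by
  have hne : ∀ ω ∈ ball (0 : ℂ) 1, 1 - (r : ℂ) * ω ≠ 0 := fun ω hω =>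
    one_sub_ne_zero_of_norm_lt (norm_ofReal_mul_lt_one h0 h1.le (by simpa using hω))
  have hA : 0 < 1 - r ^ 2 := by nlinarith
  have hcv := lintegral_image_of_hasDerivAt (measurableSet_ball (x := (0 : ℂ)) (ε := 1))
    (fun ω hω => hasDerivAt_moebius (hne ω hω))
    (fun a ha b hb hab => by
      rw [← moebius_moebius h0 h1 (mem_ball_zero_iff.1 ha),
        ← moebius_moebius h0 h1 (mem_ball_zero_iff.1 hb), hab])
    (fun ζ => H ζ * ENNReal.ofReal (‖1 - (r : ℂ) * ζ‖ ^ (-(β + 2 + ν))) *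
      ENNReal.ofReal ((1 - ‖ζ‖ ^ 2) ^ β))
  rw [moebius_image_ball h0 h1] at hcv
  rw [lintegral_mul_discWeight, lintegral_mul_discWeight, hcv,
    ← lintegral_const_mul' _ _ ENNReal.ofReal_ne_top]
  refine setLIntegral_congr_fun measurableSet_ball fun ω hω => ?_
  have hω1 : ‖ω‖ < 1 := by simpa using hω
  have hE : 0 < 1 - ‖ω‖ ^ 2 := by nlinarith [norm_nonneg ω]
  have hD : 0 < ‖1 - (r : ℂ) * ω‖ := norm_pos_iff.2 (hne ω hω)
  have hn : ‖1 - (r : ℂ) ^ 2‖ = 1 - r ^ 2 := by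
    rw [← Real.norm_of_nonneg hA.le, ← Complex.norm_real]
    push_cast
    rfl
  have key := moebius_weight_identity hA hD hE β ν
  have e1 : ‖-(1 - (r : ℂ) ^ 2) / (1 - r * ω) ^ 2‖ = (1 - r ^ 2) / ‖1 - (r : ℂ) * ω‖ ^ 2 := by
    rw [norm_div, norm_neg, hn, norm_pow]
  rw [e1, one_sub_mul_moebius (hne ω hω), one_sub_norm_moebius_sq (hne ω hω), norm_div, hn,
    mul_assoc, ← ENNReal.ofReal_mul (by positivity), mul_left_comm,
    ← ENNReal.ofReal_mul (by positivity), key, mul_assoc, ← ENNReal.ofReal_mul (by positivity),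
    mul_left_comm (ENNReal.ofReal ((1 - r ^ 2) ^ (-ν))), ← ENNReal.ofReal_mul (by positivity)]

/-! ### Gamma-type integrals on the line -/

theorem lintegral_rpow_mul_exp_neg_mul {a c : ℝ} (ha : 0 < a) (hc : 0 < c) :
    ∫⁻ τ in Set.Ioi (0 : ℝ), ENNReal.ofReal (τ ^ (a - 1) * Real.exp (-(c * τ))) =
      ENNReal.ofReal (c ^ (-a) * Real.Gamma a) := by
  have h := Real.integral_rpow_mul_exp_neg_mul_Ioi ha hc
  have hpos : 0 < (1 / c) ^ a * Real.Gamma a :=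
    mul_pos (by positivity) (Real.Gamma_pos_of_pos ha)
  rw [← ofReal_integral_eq_lintegral_ofReal]
  · rw [h, one_div, Real.inv_rpow hc.le, ← Real.rpow_neg hc.le]
  · by_contra hni
    rw [integral_undef hni] at h
    exact hpos.ne h
  · filter_upwards [ae_restrict_mem measurableSet_Ioi] with τ hτ
    have : (0 : ℝ) < τ := hτ
    positivity

theorem lintegral_exp_neg_mul_sq {c : ℝ} (hc : 0 < c) :
    ∫⁻ t : ℝ, ENNReal.ofReal (Real.exp (-c * t ^ 2)) = ENNReal.ofReal √(Real.pi / c) := by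
  rw [← integral_gaussian c, ofReal_integral_eq_lintegral_ofReal (integrable_exp_neg_mul_sq hc)]
  exact Filter.Eventually.of_forall fun t => (Real.exp_pos _).le

theorem eq_div_of_mul_ofReal {a : ℝ≥0∞} {b c : ℝ} (hb : 0 < b)
    (h : a * ENNReal.ofReal b = ENNReal.ofReal c) : a = ENNReal.ofReal (c / b) := by
  rw [ENNReal.ofReal_div_of_pos hb, ← h, ENNReal.mul_div_cancel_right (by simpa using hb)
    ENNReal.ofReal_ne_top]

/-- Multiplying by `Γ(Q)` turns the power into a Gamma integral in `τ`; after Tonelli the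
`t`-integral is Gaussian and contributes `√(π/τ)`, which lowers the exponent by one half. -/
theorem lintegral_add_sq_rpow {A Q : ℝ} (hA : 0 < A) (hQ : 1 / 2 < Q) :
    ∫⁻ t : ℝ, ENNReal.ofReal ((A + t ^ 2) ^ (-Q)) =
      ENNReal.ofReal (A ^ (-(Q - 1 / 2)) * Real.Gamma (Q - 1 / 2) * √Real.pi / Real.Gamma Q) := by
  have hQ0 : 0 < Q := by linarith
  refine eq_div_of_mul_ofReal (Real.Gamma_pos_of_pos hQ0) ?_
  rw [← lintegral_mul_const _ (by fun_prop)]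
  have h1 : ∀ t : ℝ, ENNReal.ofReal ((A + t ^ 2) ^ (-Q)) * ENNReal.ofReal (Real.Gamma Q) =
      ∫⁻ τ in Set.Ioi (0 : ℝ), ENNReal.ofReal (τ ^ (Q - 1) * Real.exp (-((A + t ^ 2) * τ))) := by
    intro t
    rw [lintegral_rpow_mul_exp_neg_mul hQ0 (by positivity), ENNReal.ofReal_mul (by positivity)]
  simp_rw [h1]
  rw [lintegral_lintegral_swap (by
    apply Measurable.aemeasurable
    simp only [Function.uncurry_def]
    fun_prop), mul_assoc, mul_comm (Real.Gamma _), ← mul_assoc, mul_comm _ √Real.pi, mul_assoc,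
    ENNReal.ofReal_mul (by positivity), ← lintegral_rpow_mul_exp_neg_mul (by linarith) hA,
    ← lintegral_const_mul _ (by fun_prop)]
  refine setLIntegral_congr_fun measurableSet_Ioi fun τ hτ => ?_
  have hτ' : 0 < τ := hτ
  have h2 : ∀ t : ℝ, ENNReal.ofReal (τ ^ (Q - 1) * Real.exp (-((A + t ^ 2) * τ))) =
      ENNReal.ofReal (τ ^ (Q - 1) * Real.exp (-(A * τ))) *
        ENNReal.ofReal (Real.exp (-τ * t ^ 2)) := by
    intro t
    rw [← ENNReal.ofReal_mul (by positivity), mul_assoc, ← Real.exp_add]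
    ring_nf
  simp_rw [h2]
  rw [lintegral_const_mul _ (by fun_prop), lintegral_exp_neg_mul_sq hτ',
    ← ENNReal.ofReal_mul (by positivity), ← ENNReal.ofReal_mul (by positivity),
    Real.sqrt_div Real.pi_pos.le]
  congr 1
  have : τ ^ (Q - 1) = τ ^ (Q - 1 / 2 - 1) * √τ := by
    rw [Real.sqrt_eq_rpow, ← Real.rpow_add hτ']
    ring_nf
  rw [this]
  have := Real.sqrt_pos.2 hτ'
  field_simp

/-- The same device: a Gamma integral for `(1 + u)^(-b)`, then Tonelli. -/
theorem lintegral_rpow_mul_one_add_rpow {a b : ℝ} (ha : 0 < a) (hab : a < b) :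
    ∫⁻ u in Set.Ioi (0 : ℝ), ENNReal.ofReal (u ^ (a - 1) * (1 + u) ^ (-b)) =
      ENNReal.ofReal (Real.Gamma a * Real.Gamma (b - a) / Real.Gamma b) := by
  have hb : 0 < b := by linarith
  refine eq_div_of_mul_ofReal (Real.Gamma_pos_of_pos hb) ?_
  rw [← lintegral_mul_const _ (by fun_prop)]
  have h1 : ∀ u ∈ Set.Ioi (0 : ℝ), ENNReal.ofReal (u ^ (a - 1) * (1 + u) ^ (-b)) *
      ENNReal.ofReal (Real.Gamma b) =
      ∫⁻ τ in Set.Ioi (0 : ℝ), ENNReal.ofReal (u ^ (a - 1)) *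
        ENNReal.ofReal (τ ^ (b - 1) * Real.exp (-((1 + u) * τ))) := by
    intro u hu
    have hu' : 0 < u := hu
    rw [lintegral_const_mul _ (by fun_prop), lintegral_rpow_mul_exp_neg_mul hb (by positivity),
      ENNReal.ofReal_mul (by positivity), ENNReal.ofReal_mul (by positivity), mul_assoc]
  rw [setLIntegral_congr_fun measurableSet_Ioi h1, lintegral_lintegral_swap (by
    apply Measurable.aemeasurable
    simp only [Function.uncurry_def]
    fun_prop), ENNReal.ofReal_mul (Real.Gamma_pos_of_pos ha).le]
  have h3 := lintegral_rpow_mul_exp_neg_mul (a := b - a) (c := 1) (by linarith) one_pos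
  rw [Real.one_rpow, one_mul] at h3
  rw [← h3, ← lintegral_const_mul _ (by fun_prop)]
  refine setLIntegral_congr_fun measurableSet_Ioi fun τ hτ => ?_
  have hτ' : 0 < τ := hτ
  have h4 := lintegral_rpow_mul_exp_neg_mul ha hτ'
  have h2 : ∀ u ∈ Set.Ioi (0 : ℝ), ENNReal.ofReal (u ^ (a - 1)) *
        ENNReal.ofReal (τ ^ (b - 1) * Real.exp (-((1 + u) * τ))) =
      ENNReal.ofReal (τ ^ (b - 1) * Real.exp (-τ)) *
        ENNReal.ofReal (u ^ (a - 1) * Real.exp (-(τ * u))) := by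
    intro u hu
    have hu' : 0 < u := hu
    rw [← ENNReal.ofReal_mul (by positivity), ← ENNReal.ofReal_mul (by positivity),
      show -((1 + u) * τ) = -τ + -(τ * u) by ring, Real.exp_add]
    ring_nf
  rw [setLIntegral_congr_fun measurableSet_Ioi h2, lintegral_const_mul _ (by fun_prop), h4,
    ← ENNReal.ofReal_mul (by positivity), ← ENNReal.ofReal_mul (Real.Gamma_pos_of_pos ha).le]
  congr 1
  have : τ ^ (b - 1) * τ ^ (-a) = τ ^ (b - a - 1) := by
    rw [← Real.rpow_add hτ']
    ring_nf
  rw [← this]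
  ring_nf

/-! ### The boundary value, computed in the half-plane -/

/-- The Cayley transform from the right half-plane to the disc. -/
noncomputable def cayley (s : ℂ) : ℂ := (s - 1) / (s + 1)

theorem add_one_ne_zero_of_re_pos {s : ℂ} (hs : 0 < s.re) : s + 1 ≠ 0 := by
  intro h
  have := congrArg Complex.re h
  simp at this
  linarith

theorem one_sub_norm_cayley_sq {s : ℂ} (hs : s + 1 ≠ 0) :
    1 - ‖cayley s‖ ^ 2 = 4 * s.re / ‖s + 1‖ ^ 2 := by
  have h : ‖s + 1‖ ^ 2 ≠ 0 := by positivity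
  rw [cayley, norm_div, div_pow, eq_div_iff h, sub_mul, div_mul_cancel₀ _ h, one_mul]
  simp only [Complex.sq_norm, Complex.normSq_apply]
  simp
  ring

theorem one_sub_cayley {s : ℂ} (hs : s + 1 ≠ 0) : 1 - cayley s = 2 / (s + 1) := by
  rw [cayley]
  field_simp
  ring

theorem cayley_injOn : Set.InjOn cayley {s | 0 < s.re} := by
  intro a ha b hb hab
  have ha' := add_one_ne_zero_of_re_pos ha
  have hb' := add_one_ne_zero_of_re_pos hb
  have h := one_sub_cayley ha'
  rw [hab, one_sub_cayley hb', div_eq_div_iff hb' ha'] at h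
  linear_combination h / 2

theorem cayley_image : cayley '' {s | 0 < s.re} = ball (0 : ℂ) 1 := by
  ext ω
  simp only [Set.mem_image, mem_ball_zero_iff, Set.mem_ofPred_eq]
  constructor
  · rintro ⟨s, hs, rfl⟩
    have hne := add_one_ne_zero_of_re_pos hs
    have h := one_sub_norm_cayley_sq hne
    have : 0 < 4 * s.re / ‖s + 1‖ ^ 2 := by positivity
    rw [← sq_lt_one_iff₀ (norm_nonneg _)]
    linarith
  · intro hω
    have hne := one_sub_ne_zero_of_norm_lt hω
    have h2 : (1 + ω) / (1 - ω) + 1 = 2 / (1 - ω) := by field_simp; ring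
    have h2' : (1 + ω) / (1 - ω) + 1 ≠ 0 := by
      rw [h2]
      exact div_ne_zero two_ne_zero hne
    have hc : cayley ((1 + ω) / (1 - ω)) = ω := by
      rw [cayley, h2]
      field_simp
      ring
    refine ⟨(1 + ω) / (1 - ω), ?_, hc⟩
    have h3 := one_sub_norm_cayley_sq h2'
    rw [hc] at h3
    have h4 : 0 < 1 - ‖ω‖ ^ 2 := by nlinarith [norm_nonneg ω]
    have h5 : 0 < ‖(1 + ω) / (1 - ω) + 1‖ ^ 2 := by positivity
    rw [h3] at h4
    have h6 := (div_pos_iff_of_pos_right h5).1 h4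
    linarith

theorem hasDerivAt_cayley {s : ℂ} (hs : s + 1 ≠ 0) : HasDerivAt cayley (2 / (s + 1) ^ 2) s := by
  have h1 : HasDerivAt (fun s : ℂ => s - 1) 1 s := (hasDerivAt_id s).sub_const 1
  have h2 : HasDerivAt (fun s : ℂ => s + 1) 1 s := (hasDerivAt_id s).add_const 1
  convert! h1.div h2 hs using 1
  ring

/-- Here `U = Re s` and `D = |s + 1|`; the left side collects the Jacobian, `|1 - cayley s| = 2/D`
and `1 - |cayley s|² = 4U/D²`. -/
theorem cayley_weight_identity {U D : ℝ} (hU : 0 < U) (hD : 0 < D) (x ν : ℝ) :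
    (2 / D ^ 2) ^ 2 * ((2 / D) ^ (ν - x) * (4 * U / D ^ 2) ^ (x - 2)) =
      2 ^ (ν + x - 2) * (U ^ (x - 2) * (D ^ 2) ^ (-((x + ν) / 2))) := by
  obtain ⟨u, rfl⟩ := exists_eq_exp hU
  obtain ⟨d, rfl⟩ := exists_eq_exp hD
  obtain ⟨e, he⟩ := exists_eq_exp (x := 2) two_pos
  rw [show (4 : ℝ) = 2 ^ 2 by norm_num, he]
  simp only [← Real.exp_nat_mul, ← Real.exp_sub, ← Real.exp_add, ← Real.exp_mul]
  congr 1
  rw [← he]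
  push_cast
  ring

/-- The Cayley transform sends the singular point `1` to infinity, and the integrand becomes
`u^(x-2) ((u+1)² + t²)^(-Q)` in `s = u + it`. The `t`-integral and then the `u`-integral are the two
Gamma-type integrals above. -/
theorem lintegral_norm_one_sub_rpow_mul_discWeight {x ν : ℝ} (hx : 1 < x) (hν : 0 < ν) :
    ∫⁻ ω : ℂ, ENNReal.ofReal (‖1 - ω‖ ^ (ν - x)) * discWeight (x - 2) ω =
      ENNReal.ofReal (Real.pi * Real.Gamma (x - 1) * Real.Gamma ν /
        Real.Gamma ((x + ν) / 2) ^ 2) := by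
  have hs : MeasurableSet {s : ℂ | 0 < s.re} := measurableSet_lt measurable_const Complex.measurable_re
  have hcv := lintegral_image_of_hasDerivAt hs
    (fun s h => hasDerivAt_cayley (add_one_ne_zero_of_re_pos h)) cayley_injOn
    (fun ω => ENNReal.ofReal (‖1 - ω‖ ^ (ν - x)) * ENNReal.ofReal ((1 - ‖ω‖ ^ 2) ^ (x - 2)))
  set Q := (x + ν) / 2 with hQ
  have hQ1 : 1 / 2 < Q := by rw [hQ]; linarith
  have h1 : ∀ s ∈ {s : ℂ | 0 < s.re}, ENNReal.ofReal (‖2 / (s + 1) ^ 2‖ ^ 2) *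
      (ENNReal.ofReal (‖1 - cayley s‖ ^ (ν - x)) *
        ENNReal.ofReal ((1 - ‖cayley s‖ ^ 2) ^ (x - 2))) =
      ENNReal.ofReal (2 ^ (ν + x - 2)) *
        ENNReal.ofReal (s.re ^ (x - 2) * ((s.re + 1) ^ 2 + s.im ^ 2) ^ (-Q)) := by
    intro s hs
    have hs' : 0 < s.re := hs
    have hne := add_one_ne_zero_of_re_pos hs'
    have hD : 0 < ‖s + 1‖ := norm_pos_iff.2 hne
    have hsq : (s.re + 1) ^ 2 + s.im ^ 2 = ‖s + 1‖ ^ 2 := by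
      rw [Complex.sq_norm, Complex.normSq_apply]
      simp
      ring
    rw [hsq, one_sub_cayley hne, one_sub_norm_cayley_sq hne, norm_div, norm_div, norm_pow,
      Complex.norm_ofNat, ← ENNReal.ofReal_mul (by positivity), ← ENNReal.ofReal_mul (by positivity),
      ← ENNReal.ofReal_mul (by positivity), cayley_weight_identity hs' hD]
  rw [lintegral_mul_discWeight, ← cayley_image, hcv, setLIntegral_congr_fun hs h1,
    lintegral_const_mul _ (by fun_prop)]
  have h2 : ∫⁻ s in {s : ℂ | 0 < s.re},
      ENNReal.ofReal (s.re ^ (x - 2) * ((s.re + 1) ^ 2 + s.im ^ 2) ^ (-Q)) =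
      ∫⁻ u in Set.Ioi (0 : ℝ), ∫⁻ t : ℝ,
        ENNReal.ofReal (u ^ (x - 2) * ((u + 1) ^ 2 + t ^ 2) ^ (-Q)) := by
    have hset : {s : ℂ | 0 < s.re} =
        Complex.measurableEquivRealProd ⁻¹' (Set.Ioi (0 : ℝ) ×ˢ Set.univ) := by
      ext s; simp [Complex.measurableEquivRealProd]
    have := Complex.volume_preserving_equiv_real_prod.setLIntegral_comp_preimage
      (s := Set.Ioi (0 : ℝ) ×ˢ Set.univ) (measurableSet_Ioi.prod MeasurableSet.univ)
      (f := fun p : ℝ × ℝ => ENNReal.ofReal (p.1 ^ (x - 2) * ((p.1 + 1) ^ 2 + p.2 ^ 2) ^ (-Q)))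
      (by fun_prop)
    rw [hset]
    refine Eq.trans this ?_
    rw [Measure.volume_eq_prod, ← Measure.prod_restrict, Measure.restrict_univ,
      lintegral_prod _ (by fun_prop)]
  have h3 : ∀ u ∈ Set.Ioi (0 : ℝ), ∫⁻ t : ℝ,
        ENNReal.ofReal (u ^ (x - 2) * ((u + 1) ^ 2 + t ^ 2) ^ (-Q)) =
      ENNReal.ofReal (Real.Gamma (Q - 1 / 2) * √Real.pi / Real.Gamma Q) *
        ENNReal.ofReal (u ^ (x - 1 - 1) * (1 + u) ^ (-(2 * Q - 1))) := by
    intro u hu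
    have hu' : 0 < u := hu
    have hG := Real.Gamma_pos_of_pos (show 0 < Q - 1 / 2 by linarith)
    have hG2 := Real.Gamma_pos_of_pos (show 0 < Q by linarith)
    simp_rw [ENNReal.ofReal_mul (Real.rpow_nonneg hu'.le (x - 2))]
    rw [lintegral_const_mul _ (by fun_prop), lintegral_add_sq_rpow (by positivity) hQ1,
      ← ENNReal.ofReal_mul (by positivity), ← ENNReal.ofReal_mul (by positivity)]
    congr 1
    rw [← Real.rpow_natCast (u + 1) 2, ← Real.rpow_mul (by positivity), add_comm 1 u]
    have e1 : ((2 : ℕ) : ℝ) * -(Q - 1 / 2) = -(2 * Q - 1) := by push_cast; ring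
    have e2 : x - 1 - 1 = x - 2 := by ring
    rw [e1, e2]
    ring
  rw [h2, setLIntegral_congr_fun measurableSet_Ioi h3, lintegral_const_mul _ (by fun_prop),
    lintegral_rpow_mul_one_add_rpow (by linarith) (by rw [hQ]; linarith),
    ← ENNReal.ofReal_mul (by
      have := Real.Gamma_pos_of_pos (show 0 < Q - 1 / 2 by linarith)
      have := Real.Gamma_pos_of_pos (show 0 < Q by linarith)
      positivity), ← ENNReal.ofReal_mul (by positivity)]
  congr 1
  -- Duplication replaces `Γ(Q - 1/2) / Γ(2Q - 1)` by a multiple of `1 / Γ(Q)`, whence the square in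
  -- the denominator; the powers of two cancel.
  have hdup := Real.Gamma_mul_Gamma_add_half (Q - 1 / 2)
  have e1 : Q - 1 / 2 + 1 / 2 = Q := by ring
  have e2 : 2 * (Q - 1 / 2) = 2 * Q - 1 := by ring
  have e3 : 2 * Q - 1 - (x - 1) = ν := by rw [hQ]; ring
  have e4 : (2 : ℝ) ^ (1 - (2 * Q - 1)) = (2 ^ (ν + x - 2))⁻¹ := by
    rw [← Real.rpow_neg two_pos.le]
    congr 1
    rw [hQ]; ring
  rw [e1, e2, e4] at hdup
  rw [e3]
  have hG2 := (Real.Gamma_pos_of_pos (show 0 < Q by linarith)).ne'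
  have hG3 := (Real.Gamma_pos_of_pos (show 0 < 2 * Q - 1 by linarith)).ne'
  have h2p : (2 : ℝ) ^ (ν + x - 2) ≠ 0 := by positivity
  have hdup' : Real.Gamma (Q - 1 / 2) = Real.Gamma (2 * Q - 1) * (2 ^ (ν + x - 2))⁻¹ * √Real.pi /
      Real.Gamma Q := by rw [← hdup]; field_simp
  rw [hdup']
  field_simp
  rw [Real.sq_sqrt Real.pi_pos.le]
  ring

/-- The value at `r = 1` of the mean of `|1 - rω|^(ν-x)`; this is Gauss's summation formula. -/
theorem lintegral_norm_one_sub_rpow_discMeasure {x ν : ℝ} (hx : 1 < x) (hν : 0 < ν) :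
    ∫⁻ ω : ℂ, ENNReal.ofReal (‖1 - ω‖ ^ (ν - x)) ∂discMeasure (x - 2) =
      ENNReal.ofReal (Real.Gamma x * Real.Gamma ν / Real.Gamma ((x + ν) / 2) ^ 2) := by
  rw [lintegral_discMeasure _ _ (by fun_prop), lintegral_norm_one_sub_rpow_mul_discWeight hx hν,
    ← ENNReal.ofReal_mul (div_nonneg (by linarith) Real.pi_pos.le)]
  have h := Real.Gamma_add_one (show x - 1 ≠ 0 by linarith)
  rw [sub_add_cancel] at h
  rw [h, show x - 2 + 1 = x - 1 by ring]
  congr 1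
  have := Real.pi_ne_zero
  field_simp

theorem lintegral_norm_rpow_discMeasure {x k : ℝ} (hx : 1 < x) (hk : 0 ≤ k) :
    ∫⁻ ω : ℂ, ENNReal.ofReal (‖ω‖ ^ k) ∂discMeasure (x - 2) =
      ENNReal.ofReal (Real.Gamma x * Real.Gamma (k / 2 + 1) / Real.Gamma (x + k / 2)) := by
  rw [lintegral_discMeasure _ _ (by fun_prop), lintegral_norm_rpow_mul_discWeight (by linarith) hk,
    ← ENNReal.ofReal_mul (div_nonneg (by linarith) Real.pi_pos.le)]
  have h := Real.Gamma_add_one (show x - 1 ≠ 0 by linarith)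
  rw [sub_add_cancel] at h
  rw [h, show x - 2 + 1 = x - 1 by ring, show k / 2 + 1 + (x - 1) = x + k / 2 by ring]
  congr 1
  have := Real.pi_ne_zero
  field_simp

/-! ### Parseval on the disc and monotonicity in the radius -/

theorem ae_norm_lt_one_discMeasure (β : ℝ) : ∀ᵐ ω ∂discMeasure β, ‖ω‖ < 1 := by
  refine (Measure.smul_absolutelyContinuous).ae_le ?_
  change ∀ᵐ ω ∂volume.withDensity (discWeight β), ‖ω‖ < 1
  rw [ae_withDensity_iff (measurable_discWeight β)]
  refine Eventually.of_forall fun ω h => ?_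
  by_contra h'
  exact h (by simp [discWeight, h'])

theorem measurePreserving_rotation_discMeasure (β : ℝ) (u : Circle) :
    MeasurePreserving (fun ω => (u : ℂ) * ω) (discMeasure β) (discMeasure β) := by
  have hm : Measurable fun ω : ℂ => (u : ℂ) * ω := by fun_prop
  refine ⟨hm, Measure.ext_of_lintegral _ fun F hF => ?_⟩
  have hvol := (rotation u).measurePreserving
  rw [lintegral_map hF hm, lintegral_discMeasure _ (fun ω => F (u * ω)) (hF.comp hm),
    lintegral_discMeasure _ _ hF,
    ← hvol.lintegral_comp (show Measurable fun ω => F ω * discWeight β ω from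
      hF.mul (measurable_discWeight β))]
  congr 1
  refine lintegral_congr fun ω => ?_
  have h2 : discWeight β (u * ω) = discWeight β ω := by
    simp only [discWeight, norm_mul, Circle.norm_coe, one_mul]
  rw [rotation_apply]
  rw [h2]

/-- The rotation by the angle `π/(j - k)` preserves the measure and changes the sign of the
integrand. -/
theorem integral_pow_mul_conj_pow_discMeasure (β : ℝ) {j k : ℕ} (hjk : j ≠ k) :
    ∫ ω, ω ^ j * conj ω ^ k ∂discMeasure β = 0 := by
  set d : ℂ := (j : ℂ) - k with hd
  have hd0 : d ≠ 0 := sub_ne_zero.2 (by exact_mod_cast hjk)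
  set u : ℂ := Complex.exp ((Real.pi / ((j : ℝ) - k) : ℝ) * Complex.I) with hu
  have hu1 : u = (Circle.exp (Real.pi / ((j : ℝ) - k)) : ℂ) := (Circle.coe_exp _).symm
  have hconj : conj u = Complex.exp (-((Real.pi / ((j : ℝ) - k) : ℝ) * Complex.I)) := by
    rw [hu, ← Complex.exp_conj]
    simp
  have huu : u ^ j * conj u ^ k = -1 := by
    rw [hconj, hu, ← Complex.exp_nat_mul, ← Complex.exp_nat_mul, ← Complex.exp_add, ← Complex.exp_pi_mul_I]
    congr 1
    push_cast
    rw [← hd]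
    field_simp
    rw [hd]
    ring
  have hmp := measurePreserving_rotation_discMeasure β (Circle.exp (Real.pi / ((j : ℝ) - k)))
  rw [← hu1] at hmp
  have hemb : MeasurableEmbedding fun ω : ℂ => u * ω :=
    (Homeomorph.mulLeft₀ u (Complex.exp_ne_zero _)).measurableEmbedding
  have h := hmp.integral_comp hemb (fun ω => ω ^ j * conj ω ^ k)
  have h2 : ∀ ω : ℂ, (u * ω) ^ j * conj (u * ω) ^ k = -1 * (ω ^ j * conj ω ^ k) := by
    intro ω
    rw [← huu, map_mul]
    ring
  simp_rw [h2] at h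
  rw [integral_const_mul] at h
  linear_combination (-1 / 2 : ℂ) * h

theorem integrable_discMeasure_of_bound {β : ℝ} (hβ : -1 < β) {f : ℂ → ℂ}
    (hf : AEStronglyMeasurable f (discMeasure β)) {C : ℝ} (hC : ∀ ω, ‖ω‖ < 1 → ‖f ω‖ ≤ C) :
    Integrable f (discMeasure β) := by
  have := isProbabilityMeasure_discMeasure hβ
  refine Integrable.of_bound hf C ?_
  filter_upwards [ae_norm_lt_one_discMeasure β] with ω hω using hC ω hω

/-- Parseval's identity for polynomials in the weighted Bergman space of the disc. -/
theorem integral_norm_sq_polynomial {β : ℝ} (hβ : -1 < β) (d : ℕ → ℂ) (n : ℕ) :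
    ∫ ω, ‖∑ k ∈ Finset.range n, d k * ω ^ k‖ ^ 2 ∂discMeasure β =
      ∑ k ∈ Finset.range n, ‖d k‖ ^ 2 * ∫ ω, ‖ω‖ ^ (2 * k) ∂discMeasure β := by
  have := isProbabilityMeasure_discMeasure hβ
  have hint : ∀ j k : ℕ, Integrable (fun ω : ℂ => ω ^ j * conj ω ^ k) (discMeasure β) := by
    intro j k
    refine integrable_discMeasure_of_bound hβ (C := 1)
      (by fun_prop) fun ω hω => ?_
    rw [norm_mul, norm_pow, norm_pow, RCLike.norm_conj]
    exact mul_le_one₀ (pow_le_one₀ (norm_nonneg _) hω.le) (by positivity)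
      (pow_le_one₀ (norm_nonneg _) hω.le)
  have hC : ((∫ ω, ‖∑ k ∈ Finset.range n, d k * ω ^ k‖ ^ 2 ∂discMeasure β : ℝ) : ℂ) =
      ((∑ k ∈ Finset.range n, ‖d k‖ ^ 2 * ∫ ω, ‖ω‖ ^ (2 * k) ∂discMeasure β : ℝ) : ℂ) := by
    rw [← integral_complex_ofReal]
    have h1 : ∀ ω : ℂ, ((‖∑ k ∈ Finset.range n, d k * ω ^ k‖ ^ 2 : ℝ) : ℂ) =
        ∑ j ∈ Finset.range n, ∑ k ∈ Finset.range n,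
          (d j * conj (d k)) * (ω ^ j * conj ω ^ k) := by
      intro ω
      rw [Complex.ofReal_pow, ← Complex.mul_conj', map_sum, Finset.sum_mul_sum]
      refine Finset.sum_congr rfl fun j _ => Finset.sum_congr rfl fun k _ => ?_
      rw [map_mul, map_pow]
      ring
    simp_rw [h1]
    rw [integral_finsetSum _ fun j _ => integrable_finsetSum _ fun k _ => (hint j k).const_mul _]
    push_cast
    refine Finset.sum_congr rfl fun j hj => ?_
    rw [integral_finsetSum _ fun k _ => (hint j k).const_mul _,
      Finset.sum_eq_single_of_mem j hj]
    · rw [integral_const_mul, Complex.mul_conj', ← integral_complex_ofReal]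
      congr 1
      refine integral_congr_ae (Eventually.of_forall fun ω => ?_)
      simp only
      rw [← mul_pow, Complex.mul_conj']
      push_cast
      rw [pow_mul]
    · intro k _ hkj
      rw [integral_const_mul, integral_pow_mul_conj_pow_discMeasure β hkj.symm, mul_zero]
  exact_mod_cast hC

/-- Dilation multiplies the `k`-th coefficient by `ρ^k ≤ 1`, so Parseval compares the partial sums;
dominated convergence passes to the series. -/
theorem integral_norm_sq_dilation_le {β : ℝ} (hβ : -1 < β) {c : ℕ → ℂ}
    (hc : Summable fun k => ‖c k‖) {ρ : ℝ} (h0 : 0 ≤ ρ) (h1 : ρ ≤ 1) :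
    ∫ ω, ‖∑' k, c k * (ρ * ω) ^ k‖ ^ 2 ∂discMeasure β ≤
      ∫ ω, ‖∑' k, c k * ω ^ k‖ ^ 2 ∂discMeasure β := by
  have := isProbabilityMeasure_discMeasure hβ
  have hlim : ∀ s : ℝ, 0 ≤ s → s ≤ 1 → Tendsto
      (fun n => ∫ ω, ‖∑ k ∈ Finset.range n, c k * (s * ω) ^ k‖ ^ 2 ∂discMeasure β) atTop
      (𝓝 (∫ ω, ‖∑' k, c k * (s * ω) ^ k‖ ^ 2 ∂discMeasure β)) := by
    intro s hs0 hs1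
    refine tendsto_integral_of_dominated_convergence (fun _ => (∑' k, ‖c k‖) ^ 2) ?_
      (integrable_const _) ?_ ?_
    · intro n
      fun_prop
    · intro n
      filter_upwards [ae_norm_lt_one_discMeasure β] with ω hω
      have hω' := (norm_ofReal_mul_lt_one hs0 hs1 hω).le
      rw [Real.norm_of_nonneg (by positivity)]
      gcongr
      refine (norm_sum_le _ _).trans ((Finset.sum_le_sum fun k _ => ?_).trans
        (hc.sum_le_tsum _ fun _ _ => norm_nonneg _))
      rw [norm_mul, norm_pow]
      exact mul_le_of_le_one_right (norm_nonneg _) (pow_le_one₀ (norm_nonneg _) hω')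
    · filter_upwards [ae_norm_lt_one_discMeasure β] with ω hω
      have hω' := (norm_ofReal_mul_lt_one hs0 hs1 hω).le
      have hsum : Summable fun k => c k * ((s : ℂ) * ω) ^ k := by
        refine Summable.of_norm_bounded hc fun k => ?_
        rw [norm_mul, norm_pow]
        exact mul_le_of_le_one_right (norm_nonneg _) (pow_le_one₀ (norm_nonneg _) hω')
      exact (hsum.hasSum.tendsto_sum_nat.norm).pow 2
  have hone := hlim 1 zero_le_one le_rfl
  simp only [Complex.ofReal_one, one_mul] at hone
  refine le_of_tendsto_of_tendsto' (hlim ρ h0 h1) hone fun n => ?_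
  have e : ∀ ω : ℂ, ∑ k ∈ Finset.range n, c k * ((ρ : ℂ) * ω) ^ k =
      ∑ k ∈ Finset.range n, (c k * (ρ : ℂ) ^ k) * ω ^ k := fun ω =>
    Finset.sum_congr rfl fun k _ => by rw [mul_pow, mul_assoc]
  simp_rw [e]
  rw [integral_norm_sq_polynomial hβ, integral_norm_sq_polynomial hβ]
  refine Finset.sum_le_sum fun k _ => ?_
  refine mul_le_mul_of_nonneg_right ?_ (integral_nonneg fun _ => by positivity)
  gcongr
  rw [norm_mul, norm_pow, Complex.norm_real, Real.norm_of_nonneg h0]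
  exact mul_le_of_le_one_right (norm_nonneg _) (pow_le_one₀ h0 h1)

theorem re_one_sub_pos {u : ℂ} (hu : ‖u‖ < 1) : 0 < (1 - u).re := by
  have := (Complex.re_le_norm u).trans_lt hu
  simp
  linarith

theorem continuousOn_norm_one_sub_mul_rpow {r q : ℝ} (h0 : 0 ≤ r) (h1 : r < 1) :
    ContinuousOn (fun ω : ℂ => ‖1 - (r : ℂ) * ω‖ ^ q) (closedBall 0 1) := by
  refine ContinuousOn.rpow_const (by fun_prop) fun ω hω => Or.inl ?_
  refine norm_ne_zero_iff.2 (one_sub_ne_zero_of_norm_lt ?_)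
  rw [norm_mul, Complex.norm_real, Real.norm_of_nonneg h0]
  have := mem_closedBall_zero_iff.1 hω
  nlinarith [norm_nonneg ω]

theorem integrable_norm_one_sub_mul_rpow {β r q : ℝ} (hβ : -1 < β) (h0 : 0 ≤ r) (h1 : r < 1) :
    Integrable (fun ω : ℂ => ‖1 - (r : ℂ) * ω‖ ^ q) (discMeasure β) := by
  have := isProbabilityMeasure_discMeasure hβ
  obtain ⟨C, hC⟩ := (isCompact_closedBall (0 : ℂ) 1).exists_bound_of_continuousOn
    (continuousOn_norm_one_sub_mul_rpow (q := q) h0 h1)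
  refine Integrable.of_bound (Measurable.aestronglyMeasurable (by fun_prop)) C ?_
  filter_upwards [ae_norm_lt_one_discMeasure β] with ω hω
  exact hC ω (mem_closedBall_zero_iff.2 hω.le)

/-- The integrand is `|f(rω)|²` with `f(z) = (1 - z)^(q/2)` holomorphic on the disc, whatever the
sign of `q`. Passing from `s` to `r` is a dilation by `r/s`. -/
theorem integral_norm_one_sub_mul_rpow_mono {β r s q : ℝ} (hβ : -1 < β) (h0 : 0 ≤ r)
    (hrs : r ≤ s) (h1 : s < 1) :
    ∫ ω, ‖1 - (r : ℂ) * ω‖ ^ q ∂discMeasure β ≤ ∫ ω, ‖1 - (s : ℂ) * ω‖ ^ q ∂discMeasure β := by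
  rcases (h0.trans hrs).eq_or_lt with rfl | hs
  · rw [le_antisymm hrs h0]
  set f : ℂ → ℂ := fun z => (1 - z) ^ ((q / 2 : ℝ) : ℂ) with hf
  have hnorm : ∀ z : ℂ, ‖f z‖ ^ 2 = ‖1 - z‖ ^ q := by
    intro z
    rw [hf, Complex.norm_cpow_real, ← Real.rpow_natCast, ← Real.rpow_mul (norm_nonneg _)]
    congr 1
    push_cast
    ring
  have hd : DifferentiableOn ℂ f (ball 0 1) := fun z hz =>
    (DifferentiableAt.cpow_const (by fun_prop)
      (Or.inl (re_one_sub_pos (mem_ball_zero_iff.1 hz)))).differentiableWithinAt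
  set c : ℕ → ℂ := fun k => (k.factorial : ℂ)⁻¹ * iteratedDeriv k f 0 * (s : ℂ) ^ k with hc
  have hsum : ∀ z : ℂ, ‖(s : ℂ) * z‖ < 1 → HasSum (fun k => c k * z ^ k) (f (s * z)) := by
    intro z hz
    have h := Complex.hasSum_taylorSeries_on_ball hd (mem_ball_zero_iff.2 hz)
    convert! h using 2 with k
    simp only [hc, smul_eq_mul, sub_zero]
    ring
  -- Since `s < 1`, the Taylor series of `f` converges absolutely at `s`, and the factor `s^k` is
  -- already part of `c k`.
  have hcs : Summable fun k => ‖c k‖ := by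
    have h := (hsum 1 (by simpa [abs_of_pos hs] using h1)).summable.norm
    simpa using h
  have hle := integral_norm_sq_dilation_le hβ hcs (ρ := r / s) (by positivity)
    ((div_le_one hs).2 hrs)
  have hval : ∀ ρ : ℝ, 0 ≤ ρ → ρ ≤ 1 → ∫ ω, ‖∑' k, c k * (ρ * ω) ^ k‖ ^ 2 ∂discMeasure β =
      ∫ ω, ‖1 - ((s * ρ : ℝ) : ℂ) * ω‖ ^ q ∂discMeasure β := by
    intro ρ hρ0 hρ1
    refine integral_congr_ae ?_
    filter_upwards [ae_norm_lt_one_discMeasure β] with ω hω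
    have h2 := norm_ofReal_mul_lt_one hs.le h1.le (norm_ofReal_mul_lt_one hρ0 hρ1 hω)
    rw [(hsum _ h2).tsum_eq, hnorm]
    push_cast
    rw [mul_assoc]
  rw [hval _ (by positivity) ((div_le_one hs).2 hrs), mul_div_cancel₀ _ hs.ne'] at hle
  have h3 := hval 1 zero_le_one le_rfl
  simp only [Complex.ofReal_one, one_mul, mul_one] at h3
  rwa [h3] at hle

/-! ### The limit at the boundary and the sharp disc estimate -/

/-- A majorant uniform in `r`. For negative `q` it rests on `|1 - ω| ≤ 2 |1 - rω|`, which follows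
from `(1 - r)|ω| ≤ 1 - r|ω| ≤ |1 - rω|`. -/
theorem norm_one_sub_mul_rpow_le {r q : ℝ} (h0 : 0 ≤ r) (h1 : r < 1) {ω : ℂ} (hω : ‖ω‖ < 1) :
    ‖1 - (r : ℂ) * ω‖ ^ q ≤ 2 ^ |q| * (1 + ‖1 - ω‖ ^ q) := by
  have hne := norm_pos_iff.2 (one_sub_ne_zero_of_norm_lt hω)
  have hrω := norm_ofReal_mul_lt_one h0 h1.le hω
  have hne' := norm_pos_iff.2 (one_sub_ne_zero_of_norm_lt hrω)
  have h2 : ‖1 - (r : ℂ) * ω‖ ≤ 2 := by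
    refine (norm_sub_le _ _).trans ?_
    rw [norm_one]
    linarith
  rcases le_total 0 q with hq | hq
  · rw [abs_of_nonneg hq]
    calc ‖1 - (r : ℂ) * ω‖ ^ q ≤ 2 ^ q := Real.rpow_le_rpow hne'.le h2 hq
      _ ≤ 2 ^ q * (1 + ‖1 - ω‖ ^ q) := by
        refine le_mul_of_one_le_right (by positivity) ?_
        have : 0 ≤ ‖1 - ω‖ ^ q := by positivity
        linarith
  · rw [abs_of_nonpos hq]
    have h3 : ‖1 - ω‖ / 2 ≤ ‖1 - (r : ℂ) * ω‖ := by
      have h4 : ‖1 - ω‖ ≤ ‖1 - (r : ℂ) * ω‖ + (1 - r) * ‖ω‖ := by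
        have : 1 - ω = (1 - (r : ℂ) * ω) + ((r - 1 : ℝ) : ℂ) * ω := by push_cast; ring
        rw [this]
        refine (norm_add_le _ _).trans ?_
        rw [norm_mul ((r - 1 : ℝ) : ℂ), Complex.norm_real, Real.norm_eq_abs, abs_sub_comm,
          abs_of_pos (by linarith)]
      have h5 : 1 - r * ‖ω‖ ≤ ‖1 - (r : ℂ) * ω‖ := by
        have := norm_sub_norm_le (1 : ℂ) ((r : ℂ) * ω)
        rw [norm_one, norm_mul, Complex.norm_real, Real.norm_of_nonneg h0] at this
        exact this
      nlinarith [norm_nonneg ω]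
    calc ‖1 - (r : ℂ) * ω‖ ^ q ≤ (‖1 - ω‖ / 2) ^ q :=
          Real.rpow_le_rpow_of_nonpos (by positivity) h3 hq
      _ = 2 ^ (-q) * ‖1 - ω‖ ^ q := by
        rw [Real.div_rpow hne.le two_pos.le, Real.rpow_neg two_pos.le]
        field_simp
      _ ≤ 2 ^ (-q) * (1 + ‖1 - ω‖ ^ q) := by
        gcongr
        linarith

/-- Dominated convergence; the majorant is integrable because the value at `r = 1` is finite. The
factor `H` will be either `1` or a power of `|moebius r ω|`. -/
theorem tendsto_lintegral_norm_one_sub_mul_rpow {x ν : ℝ} (hx : 1 < x) (hν : 0 < ν)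
    {H : ℝ → ℂ → ℝ≥0∞} (hH : ∀ r, Measurable (H r))
    (hH1 : ∀ r, 0 ≤ r → r < 1 → ∀ ω, ‖ω‖ < 1 → H r ω ≤ 1)
    (hHlim : ∀ ω, ‖ω‖ < 1 → Tendsto (fun r => H r ω) (𝓝[<] 1) (𝓝 1)) :
    Tendsto (fun r : ℝ => ∫⁻ ω, H r ω * ENNReal.ofReal (‖1 - (r : ℂ) * ω‖ ^ (ν - x))
        ∂discMeasure (x - 2)) (𝓝[<] 1)
      (𝓝 (ENNReal.ofReal (Real.Gamma x * Real.Gamma ν / Real.Gamma ((x + ν) / 2) ^ 2))) := by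
  have := isProbabilityMeasure_discMeasure (show -1 < x - 2 by linarith)
  rw [← lintegral_norm_one_sub_rpow_discMeasure hx hν]
  have hr : ∀ᶠ r : ℝ in 𝓝[<] 1, r ∈ Set.Ioo (0 : ℝ) 1 := Ioo_mem_nhdsLT one_pos
  refine tendsto_lintegral_filter_of_dominated_convergence
    (fun ω => ENNReal.ofReal (2 ^ |ν - x| * (1 + ‖1 - ω‖ ^ (ν - x)))) ?_ ?_ ?_ ?_
  · exact Eventually.of_forall fun r => (hH r).mul (by fun_prop)
  · filter_upwards [hr] with r hr
    filter_upwards [ae_norm_lt_one_discMeasure (x - 2)] with ω hω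
    refine (mul_le_of_le_one_left' (hH1 r hr.1.le hr.2 ω hω)).trans ?_
    exact ENNReal.ofReal_le_ofReal (norm_one_sub_mul_rpow_le hr.1.le hr.2 hω)
  · have e : ∀ ω : ℂ, ENNReal.ofReal (2 ^ |ν - x| * (1 + ‖1 - ω‖ ^ (ν - x))) =
        ENNReal.ofReal (2 ^ |ν - x|) * (1 + ENNReal.ofReal (‖1 - ω‖ ^ (ν - x))) := by
      intro ω
      rw [ENNReal.ofReal_mul (by positivity), ENNReal.ofReal_add zero_le_one (by positivity),
        ENNReal.ofReal_one]
    simp_rw [e]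
    rw [lintegral_const_mul _ (by fun_prop), lintegral_add_left measurable_const,
      lintegral_norm_one_sub_rpow_discMeasure hx hν]
    simp [ENNReal.mul_eq_top]
  · filter_upwards [ae_norm_lt_one_discMeasure (x - 2)] with ω hω
    have h1 : Tendsto (fun r : ℝ => ENNReal.ofReal (‖1 - (r : ℂ) * ω‖ ^ (ν - x))) (𝓝[<] 1)
        (𝓝 (ENNReal.ofReal (‖1 - ω‖ ^ (ν - x)))) := by
      refine tendsto_nhdsWithin_of_tendsto_nhds ?_
      have hc : ContinuousAt (fun r : ℝ => ‖1 - (r : ℂ) * ω‖ ^ (ν - x)) 1 := by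
        refine ContinuousAt.rpow_const (by fun_prop) (Or.inl ?_)
        simpa using one_sub_ne_zero_of_norm_lt hω
      have h2 := (ENNReal.continuous_ofReal.tendsto _).comp hc.tendsto
      simpa [Function.comp_def] using h2
    have h3 := ENNReal.Tendsto.mul (hHlim ω hω) (Or.inl one_ne_zero) h1
      (Or.inr ENNReal.one_ne_top)
    rwa [one_mul] at h3

/-- By monotonicity in the radius, the limit at `r = 1` bounds every earlier value. -/
theorem lintegral_norm_one_sub_mul_rpow_le {x ν r : ℝ} (hx : 1 < x) (hν : 0 < ν)
    (h0 : 0 ≤ r) (h1 : r < 1) :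
    ∫⁻ ω, ENNReal.ofReal (‖1 - (r : ℂ) * ω‖ ^ (ν - x)) ∂discMeasure (x - 2) ≤
      ENNReal.ofReal (Real.Gamma x * Real.Gamma ν / Real.Gamma ((x + ν) / 2) ^ 2) := by
  have hβ : -1 < x - 2 := by linarith
  have hlim := tendsto_lintegral_norm_one_sub_mul_rpow hx hν (H := fun _ _ => 1)
    (fun _ => measurable_const) (fun _ _ _ _ _ => le_rfl) (fun _ _ => tendsto_const_nhds)
  simp only [one_mul] at hlim
  refine ge_of_tendsto hlim ?_
  filter_upwards [Ioo_mem_nhdsLT h1] with s hs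
  rw [← ofReal_integral_eq_lintegral_ofReal (integrable_norm_one_sub_mul_rpow hβ h0 h1)
    (Eventually.of_forall fun _ => by positivity),
    ← ofReal_integral_eq_lintegral_ofReal
    (integrable_norm_one_sub_mul_rpow hβ (h0.trans hs.1.le) hs.2)
    (Eventually.of_forall fun _ => by positivity)]
  exact ENNReal.ofReal_le_ofReal (integral_norm_one_sub_mul_rpow_mono hβ h0 hs.1.le hs.2)

theorem lintegral_moebius_discMeasure {r x ν : ℝ} (h0 : 0 ≤ r) (h1 : r < 1) {H : ℂ → ℝ≥0∞}
    (hH : Measurable H) :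
    ∫⁻ ζ, H ζ * ENNReal.ofReal (‖1 - (r : ℂ) * ζ‖ ^ (-(x + ν))) ∂discMeasure (x - 2) =
      ENNReal.ofReal ((1 - r ^ 2) ^ (-ν)) *
        ∫⁻ ω, H (moebius r ω) * ENNReal.ofReal (‖1 - (r : ℂ) * ω‖ ^ (ν - x))
          ∂discMeasure (x - 2) := by
  have hmoeb : Measurable (moebius r) := by
    unfold moebius
    fun_prop
  have hH' : Measurable fun ω => H (moebius r ω) := hH.comp hmoeb
  rw [lintegral_discMeasure _ (fun ζ => H ζ * ENNReal.ofReal (‖1 - (r : ℂ) * ζ‖ ^ (-(x + ν))))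
      (by fun_prop),
    lintegral_discMeasure _
      (fun ω => H (moebius r ω) * ENNReal.ofReal (‖1 - (r : ℂ) * ω‖ ^ (ν - x))) (by fun_prop)]
  have h := lintegral_moebius (β := x - 2) (ν := ν) h0 h1 H
  rw [show x - 2 + 2 = x by ring] at h
  rw [h, mul_left_comm]

/-- The sharp Forelli–Rudin estimate on the disc. -/
theorem lintegral_forelliRudin_le {r x ν : ℝ} (hx : 1 < x) (hν : 0 < ν) (h0 : 0 ≤ r)
    (h1 : r < 1) :
    ENNReal.ofReal ((1 - r ^ 2) ^ ν) *
      ∫⁻ ζ, ENNReal.ofReal (‖1 - (r : ℂ) * ζ‖ ^ (-(x + ν))) ∂discMeasure (x - 2) ≤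
      ENNReal.ofReal (Real.Gamma x * Real.Gamma ν / Real.Gamma ((x + ν) / 2) ^ 2) := by
  have hA : 0 < 1 - r ^ 2 := by nlinarith
  have h := lintegral_moebius_discMeasure (x := x) (ν := ν) h0 h1 (H := fun _ => 1) measurable_const
  simp only [one_mul] at h
  rw [h, ← mul_assoc, ← ENNReal.ofReal_mul (by positivity), ← Real.rpow_add hA, add_neg_cancel,
    Real.rpow_zero, ENNReal.ofReal_one, one_mul]
  exact lintegral_norm_one_sub_mul_rpow_le hx hν h0 h1

/-- After the automorphism, `|ζ|^k` becomes `|moebius r ω|^k`, which tends to `1`. Hence the bound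
`|w^m| ≤ 1` in the upper estimate loses nothing in the limit. -/
theorem tendsto_lintegral_forelliRudin {x ν : ℝ} (hx : 1 < x) (hν : 0 < ν) (k : ℕ) :
    Tendsto (fun r : ℝ => ENNReal.ofReal ((1 - r ^ 2) ^ ν) *
      ∫⁻ ζ, ENNReal.ofReal (‖ζ‖ ^ k) * ENNReal.ofReal (‖1 - (r : ℂ) * ζ‖ ^ (-(x + ν)))
        ∂discMeasure (x - 2)) (𝓝[<] 1)
      (𝓝 (ENNReal.ofReal (Real.Gamma x * Real.Gamma ν / Real.Gamma ((x + ν) / 2) ^ 2))) := by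
  have hmoeb : ∀ r, Measurable (moebius r) := by
    intro r
    unfold moebius
    fun_prop
  have hlim := tendsto_lintegral_norm_one_sub_mul_rpow hx hν
    (H := fun r ω => ENNReal.ofReal (‖moebius r ω‖ ^ k))
    (fun r => by have := hmoeb r; fun_prop)
    (fun r h0 h1 ω hω => by
      rw [← ENNReal.ofReal_one]
      exact ENNReal.ofReal_le_ofReal
        (pow_le_one₀ (norm_nonneg _) (norm_moebius_lt_one h0 h1 hω).le))
    (fun ω hω => by
      have hne := one_sub_ne_zero_of_norm_lt hω
      refine tendsto_nhdsWithin_of_tendsto_nhds ?_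
      have hc : ContinuousAt (fun r : ℝ => ‖moebius r ω‖ ^ k) 1 := by
        unfold moebius
        refine ContinuousAt.pow (ContinuousAt.norm (ContinuousAt.div (by fun_prop) (by fun_prop) ?_)) k
        simpa using hne
      have h2 := (ENNReal.continuous_ofReal.tendsto _).comp hc.tendsto
      simpa [Function.comp_def, moebius, div_self hne] using h2)
  refine hlim.congr' ?_
  filter_upwards [Ioo_mem_nhdsLT one_pos] with r hr
  have hA : 0 < 1 - r ^ 2 := by nlinarith [hr.1, hr.2]
  rw [lintegral_moebius_discMeasure hr.1.le hr.2 (H := fun ζ => ENNReal.ofReal (‖ζ‖ ^ k))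
    (by fun_prop), ← mul_assoc, ← ENNReal.ofReal_mul (by positivity), ← Real.rpow_add hA,
    add_neg_cancel, Real.rpow_zero, ENNReal.ofReal_one, one_mul]

/-! ### Unitary invariance and reduction from the ball to the disc -/

theorem measurePreserving_weightedMeasure {n : ℕ} (α : ℝ) (U : Cn n ≃ₗᵢ[ℂ] Cn n) :
    MeasurePreserving U (weightedMeasure n α) (weightedMeasure n α) := by
  let UR : Cn n ≃ₗᵢ[ℝ] Cn n := ⟨U.toLinearEquiv.restrictScalars ℝ, U.norm_map⟩
  have hvol : MeasurePreserving U (volume : Measure (Cn n)) volume := UR.measurePreserving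
  have hm : Measurable U := U.continuous.measurable
  have hball : MeasurePreserving U (ballMeasure n) (ballMeasure n) := by
    have h := hvol.restrict_preimage (s := unitBall n) measurableSet_ball
    have hpre : U ⁻¹' unitBall n = unitBall n := by
      ext z
      simp [unitBall]
    rw [hpre] at h
    exact h.smul_measure _
  refine ⟨hm, Measure.ext_of_lintegral _ fun F hF => ?_⟩
  have h1 : ∀ G : Cn n → ℝ≥0∞, Measurable G → ∫⁻ z, G z ∂weightedMeasure n α =
      weightConst n α * ∫⁻ z, ENNReal.ofReal ((1 - ‖z‖ ^ 2) ^ α) * G z ∂ballMeasure n := by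
    intro G hG
    rw [weightedMeasure, lintegral_smul_measure,
      lintegral_withDensity_eq_lintegral_mul _ (measurable_weight n α) hG]
    rfl
  rw [lintegral_map hF hm, h1 (fun z => F (U z)) (hF.comp hm), h1 _ hF, ← hball.lintegral_comp
    (f := fun z => ENNReal.ofReal ((1 - ‖z‖ ^ 2) ^ α) * F z) ((measurable_weight n α).mul hF)]
  simp

/-- The unit vector `z / ‖z‖` extends to an orthonormal basis, and `U` is the coordinate map of that
basis. -/
theorem exists_isometry_inner_eq {n : ℕ} (i : Fin n) (z : Cn n) :
    ∃ U : Cn n ≃ₗᵢ[ℂ] Cn n, ∀ w, inner ℂ z w = (‖z‖ : ℂ) * U w i := by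
  by_cases hz : z = 0
  · exact ⟨LinearIsometryEquiv.refl ℂ _, fun w => by simp [hz]⟩
  have hz' : (‖z‖ : ℂ) ≠ 0 := by simpa using hz
  have ho : Orthonormal ℂ (Set.domRestrict ({i} : Set (Fin n)) fun _ => ((‖z‖ : ℂ)⁻¹) • z) := by
    refine ⟨fun j => ?_, fun j k hjk => ?_⟩
    · simp [norm_smul, hz]
    · exact absurd (Subsingleton.elim j k) hjk
  obtain ⟨b, hb⟩ := ho.exists_orthonormalBasis_extension_of_card_eq (by simp)
  refine ⟨b.repr, fun w => ?_⟩
  rw [b.repr_apply_apply, hb i rfl, inner_smul_left, map_inv₀, Complex.conj_ofReal, ← mul_assoc,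
    mul_inv_cancel₀ hz', one_mul]

/-- Integrals of functions of `⟨w, z⟩` against `weightedMeasure` reduce to the disc. -/
theorem lintegral_comp_inner_weightedMeasure {n : ℕ} {α : ℝ} (hn : 1 ≤ n) (hα : -1 < α) (z : Cn n)
    {F : ℂ → ℝ≥0∞} (hF : Measurable F) :
    ∫⁻ w, F (inner ℂ z w) ∂weightedMeasure n α =
      ∫⁻ ζ, F ((‖z‖ : ℂ) * ζ) ∂discMeasure (n + 1 + α - 2) := by
  let i : Fin n := ⟨0, hn⟩
  obtain ⟨U, hU⟩ := exists_isometry_inner_eq i z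
  have hF' : Measurable fun ζ : ℂ => F ((‖z‖ : ℂ) * ζ) := by fun_prop
  have hm : Measurable (β := ℂ) fun w : Cn n => w i := by fun_prop
  simp_rw [hU]
  rw [(measurePreserving_weightedMeasure α U).lintegral_comp
    (f := fun w : Cn n => F ((‖z‖ : ℂ) * w i)) (hF'.comp hm),
    show (n : ℝ) + 1 + α - 2 = α + n - 1 by ring, ← map_coord_weightedMeasure hα i,
    lintegral_map hF' hm]

theorem lintegral_coord_weightedMeasure {n : ℕ} {α : ℝ} (hα : -1 < α) (i : Fin n)
    {F : ℂ → ℝ≥0∞} (hF : Measurable F) :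
    ∫⁻ w, F (w i) ∂weightedMeasure n α = ∫⁻ ζ, F ζ ∂discMeasure (n + 1 + α - 2) := by
  have hm : Measurable (β := ℂ) fun w : Cn n => w i := by fun_prop
  rw [show (n : ℝ) + 1 + α - 2 = α + n - 1 by ring, ← map_coord_weightedMeasure hα i,
    lintegral_map hF hm]

theorem one_lt_dim_add_one_add {n : ℕ} {α : ℝ} (hn : 1 ≤ n) (hα : -1 < α) : 1 < (n : ℝ) + 1 + α := by
  have : (1 : ℝ) ≤ n := by exact_mod_cast hn
  linarith

theorem norm_one_sub_inner_comm {n : ℕ} (z w : Cn n) :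
    ‖1 - inner ℂ w z‖ = ‖1 - inner ℂ z w‖ := by
  rw [← RCLike.norm_conj, map_sub, map_one, inner_conj_symm]

/-- The sharp Forelli–Rudin estimate on the ball. -/
theorem lintegral_norm_one_sub_inner_rpow_le {n : ℕ} {α ν : ℝ} (hn : 1 ≤ n) (hα : -1 < α)
    (hν : 0 < ν) {z : Cn n} (hz : z ∈ unitBall n) :
    ENNReal.ofReal ((1 - ‖z‖ ^ 2) ^ ν) *
      ∫⁻ w, ENNReal.ofReal (‖1 - inner ℂ w z‖ ^ (-((n : ℝ) + 1 + α + ν))) ∂weightedMeasure n α ≤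
      ENNReal.ofReal (Real.Gamma (n + 1 + α) * Real.Gamma ν /
        Real.Gamma ((n + 1 + α + ν) / 2) ^ 2) := by
  simp_rw [norm_one_sub_inner_comm]
  rw [lintegral_comp_inner_weightedMeasure hn hα z
    (F := fun u => ENNReal.ofReal (‖1 - u‖ ^ (-((n : ℝ) + 1 + α + ν)))) (by fun_prop)]
  exact lintegral_forelliRudin_le (one_lt_dim_add_one_add hn hα) hν (norm_nonneg z)
    (mem_ball_zero_iff.1 hz)

/-! ### Differentiation under the integral sign -/

/-- The integral of `h(w) (1 - ⟨z, w⟩)^(-s)`. -/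
noncomputable def cauchyIntegral {n : ℕ} (μ : Measure (Cn n)) (s : ℝ) (h : Cn n → ℂ) (z : Cn n) :
    ℂ :=
  ∫ w, h w * (1 - inner ℂ w z) ^ (-(s : ℂ)) ∂μ

theorem norm_inner_lt_one {n : ℕ} {z w : Cn n} (hz : ‖z‖ < 1) (hw : ‖w‖ < 1) :
    ‖inner ℂ w z‖ < 1 := by
  refine (norm_inner_le_norm w z).trans_lt ?_
  nlinarith [norm_nonneg z, norm_nonneg w]

theorem norm_one_sub_inner_cpow {n : ℕ} (z w : Cn n) (s : ℝ) :
    ‖(1 - inner ℂ w z) ^ (-(s : ℂ))‖ = ‖1 - inner ℂ w z‖ ^ (-s) := by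
  rw [← Complex.ofReal_neg, Complex.norm_cpow_real]

theorem norm_one_sub_inner_cpow_le {n : ℕ} {z w : Cn n} {s ρ : ℝ} (hs : 0 ≤ s) (hρ : ρ < 1)
    (hz : ‖z‖ ≤ ρ) (hw : ‖w‖ < 1) :
    ‖(1 - inner ℂ w z) ^ (-(s : ℂ))‖ ≤ (1 - ρ) ^ (-s) := by
  rw [norm_one_sub_inner_cpow]
  refine Real.rpow_le_rpow_of_nonpos (by linarith) ?_ (by linarith)
  have h1 := norm_sub_norm_le (1 : ℂ) (inner ℂ w z)
  have h2 := norm_inner_le_norm (𝕜 := ℂ) w z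
  rw [norm_one] at h1
  nlinarith [norm_nonneg z, norm_nonneg w]

theorem measurable_one_sub_inner_cpow {n : ℕ} (z : Cn n) (s : ℝ) :
    Measurable fun w : Cn n => (1 - inner ℂ w z) ^ (-(s : ℂ)) := by
  have h : Measurable fun w : Cn n => 1 - inner ℂ w z :=
    (continuous_const.sub (continuous_id.inner continuous_const)).measurable
  fun_prop

theorem integrable_cauchyIntegrand {n : ℕ} {μ : Measure (Cn n)} [IsFiniteMeasure μ]
    (hμ : ∀ᵐ w ∂μ, w ∈ unitBall n) {s C : ℝ} (hs : 0 ≤ s) {h : Cn n → ℂ}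
    (hh : AEStronglyMeasurable h μ) (hC : ∀ᵐ w ∂μ, ‖h w‖ ≤ C) {z : Cn n} (hz : z ∈ unitBall n) :
    Integrable (fun w => h w * (1 - inner ℂ w z) ^ (-(s : ℂ))) μ := by
  have hz' := mem_ball_zero_iff.1 hz
  refine Integrable.of_bound
    (hh.mul (measurable_one_sub_inner_cpow z s).aestronglyMeasurable) (C * (1 - ‖z‖) ^ (-s)) ?_
  filter_upwards [hμ, hC] with w hw hCw
  rw [norm_mul]
  exact mul_le_mul hCw (norm_one_sub_inner_cpow_le hs hz' le_rfl (mem_ball_zero_iff.1 hw))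
    (norm_nonneg _) ((norm_nonneg _).trans hCw)

theorem hasFDerivAt_one_sub_inner_cpow {n : ℕ} {z w : Cn n} (s : ℝ) (hz : ‖z‖ < 1) (hw : ‖w‖ < 1) :
    HasFDerivAt (fun z : Cn n => (1 - inner ℂ w z) ^ (-(s : ℂ)))
      (((s : ℂ) * (1 - inner ℂ w z) ^ (-((s + 1 : ℝ) : ℂ))) • innerSL ℂ w) z := by
  have h1 : HasFDerivAt (fun z : Cn n => 1 - inner ℂ w z) (-innerSL ℂ w) z := by
    exact ((innerSL ℂ w).hasFDerivAt (x := z)).const_sub 1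
  have h2 := ((hasDerivAt_id (1 - inner ℂ w z)).cpow_const (c := -(s : ℂ))
    (Or.inl (re_one_sub_pos (norm_inner_lt_one hz hw)))).comp_hasFDerivAt z h1
  refine h2.congr_fderiv ?_
  ext v
  simp only [smul_apply, neg_apply, smul_eq_mul, id]
  push_cast
  rw [neg_add']
  ring

/-- Near `z` all points stay in a ball of radius `ρ < 1`, where the differentiated kernel is at most
`s (1 - ρ)^(-(s+1))` uniformly in `w`. -/
theorem hasFDerivAt_cauchyIntegral {n : ℕ} {μ : Measure (Cn n)} [IsFiniteMeasure μ]
    (hμ : ∀ᵐ w ∂μ, w ∈ unitBall n) {s C : ℝ} (hs : 0 ≤ s) {h : Cn n → ℂ}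
    (hh : AEStronglyMeasurable h μ) (hC : ∀ᵐ w ∂μ, ‖h w‖ ≤ C) {z : Cn n} (hz : z ∈ unitBall n) :
    Integrable (fun w => (h w * ((s : ℂ) * (1 - inner ℂ w z) ^ (-((s + 1 : ℝ) : ℂ)))) •
      innerSL ℂ w) μ ∧
    HasFDerivAt (cauchyIntegral μ s h)
      (∫ w, (h w * ((s : ℂ) * (1 - inner ℂ w z) ^ (-((s + 1 : ℝ) : ℂ)))) • innerSL ℂ w ∂μ) z := by
  have hz' := mem_ball_zero_iff.1 hz
  obtain ⟨ρ, hρz, hρ1⟩ := exists_between hz'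
  have hmeas : ∀ z : Cn n, AEStronglyMeasurable
      (fun w => (h w * ((s : ℂ) * (1 - inner ℂ w z) ^ (-((s + 1 : ℝ) : ℂ)))) • innerSL ℂ w) μ :=
    fun z => (hh.mul ((measurable_one_sub_inner_cpow z (s + 1)).const_mul _).aestronglyMeasurable).smul
      (innerSL ℂ).continuous.aestronglyMeasurable
  have hbound : ∀ᵐ w ∂μ, ∀ z' ∈ ball (0 : Cn n) ρ,
      ‖(h w * ((s : ℂ) * (1 - inner ℂ w z') ^ (-((s + 1 : ℝ) : ℂ)))) • innerSL ℂ w‖ ≤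
        C * (s * (1 - ρ) ^ (-(s + 1))) := by
    filter_upwards [hμ, hC] with w hw hCw z' hz'
    have hw' := mem_ball_zero_iff.1 hw
    have h1 := norm_one_sub_inner_cpow_le (s := s + 1) (by linarith) hρ1
      (mem_ball_zero_iff.1 hz').le hw'
    have h0 : 0 ≤ C := (norm_nonneg _).trans hCw
    rw [norm_smul, norm_mul, norm_mul, innerSL_apply_norm, Complex.norm_real, Real.norm_of_nonneg hs]
    calc _ ≤ (C * (s * (1 - ρ) ^ (-(s + 1)))) * 1 := by gcongr
      _ = _ := mul_one _
  refine ⟨Integrable.of_bound (hmeas z) (C * (s * (1 - ρ) ^ (-(s + 1)))) ?_, ?_⟩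
  · filter_upwards [hbound] with w hw using hw z (mem_ball_zero_iff.2 hρz)
  refine hasFDerivAt_integral_of_dominated_of_fderiv_le (s := ball (0 : Cn n) ρ)
    (bound := fun _ => C * (s * (1 - ρ) ^ (-(s + 1))))
    (F' := fun z w => (h w * ((s : ℂ) * (1 - inner ℂ w z) ^ (-((s + 1 : ℝ) : ℂ)))) • innerSL ℂ w)
    (isOpen_ball.mem_nhds (mem_ball_zero_iff.2 hρz)) ?_
    (integrable_cauchyIntegrand hμ hs hh hC hz) (hmeas z) hbound (integrable_const _) ?_
  · exact Eventually.of_forall fun z' =>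
      hh.mul (measurable_one_sub_inner_cpow z' s).aestronglyMeasurable
  · filter_upwards [hμ] with w hw z' hz'
    rw [← smul_smul]
    exact (hasFDerivAt_one_sub_inner_cpow s ((mem_ball_zero_iff.1 hz').trans hρ1)
      (mem_ball_zero_iff.1 hw)).const_mul (h w)

theorem partialDeriv_cauchyIntegral {n : ℕ} {μ : Measure (Cn n)} [IsFiniteMeasure μ]
    (hμ : ∀ᵐ w ∂μ, w ∈ unitBall n) {s C : ℝ} (hs : 0 ≤ s) {h : Cn n → ℂ}
    (hh : AEStronglyMeasurable h μ) (hC : ∀ᵐ w ∂μ, ‖h w‖ ≤ C) (i : Fin n) {z : Cn n}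
    (hz : z ∈ unitBall n) :
    partialDeriv i (cauchyIntegral μ s h) z =
      s * cauchyIntegral μ (s + 1) (fun w => h w * conj (w i)) z := by
  obtain ⟨hint, hd⟩ := hasFDerivAt_cauchyIntegral hμ hs hh hC hz
  rw [partialDeriv, hd.hasLineDerivAt _ |>.lineDeriv, ContinuousLinearMap.integral_apply hint,
    cauchyIntegral, ← integral_const_mul]
  congr 1
  ext w
  simp [EuclideanSpace.inner_single_right]
  ring

theorem partialDeriv_congr {n : ℕ} {F G : Cn n → ℂ} (hFG : Set.EqOn F G (unitBall n)) (i : Fin n) :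
    Set.EqOn (partialDeriv i F) (partialDeriv i G) (unitBall n) := fun _ hz =>
  Filter.EventuallyEq.lineDeriv_eq (hFG.eventuallyEq_of_mem (isOpen_ball.mem_nhds hz))

theorem cauchyIntegral_const_mul {n : ℕ} (μ : Measure (Cn n)) (s : ℝ) (c : ℂ) (h : Cn n → ℂ)
    (z : Cn n) :
    cauchyIntegral μ s (fun w => c * h w) z = c * cauchyIntegral μ s h z := by
  rw [cauchyIntegral, cauchyIntegral, ← integral_const_mul]
  simp_rw [mul_assoc]

/-- The form of the `k`-th order derivatives of `cauchyIntegral μ x`. -/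
noncomputable def cauchyDeriv {n : ℕ} (μ : Measure (Cn n)) (x : ℝ) (k : ℕ) (h : Cn n → ℂ)
    (z : Cn n) : ℂ :=
  ((Real.Gamma (x + k) / Real.Gamma x : ℝ) : ℂ) * cauchyIntegral μ (x + k) h z

section

variable {n : ℕ} {μ : Measure (Cn n)} {x : ℝ}

/-- The factor `x + k` produced by differentiation is absorbed by `Γ(x + k + 1) = (x + k) Γ(x + k)`.
-/
theorem partialDeriv_cauchyDeriv [IsFiniteMeasure μ] (hμ : ∀ᵐ w ∂μ, w ∈ unitBall n) (hx : 0 < x) (k : ℕ)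
    {C : ℝ} {h : Cn n → ℂ}
    (hh : AEStronglyMeasurable h μ) (hC : ∀ᵐ w ∂μ, ‖h w‖ ≤ C) (i : Fin n) :
    Set.EqOn (partialDeriv i (cauchyDeriv μ x k h))
      (cauchyDeriv μ x (k + 1) fun w => h w * conj (w i)) (unitBall n) := by
  intro z hz
  have hxk : 0 < x + k := by positivity
  set c : ℂ := ((Real.Gamma (x + k) / Real.Gamma x : ℝ) : ℂ) with hc
  have e : cauchyDeriv μ x k h = cauchyIntegral μ (x + k) (fun w => c * h w) := by
    ext z
    rw [cauchyIntegral_const_mul, cauchyDeriv]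
  have hC' : ∀ᵐ w ∂μ, ‖c * h w‖ ≤ ‖c‖ * C := by
    filter_upwards [hC] with w hw
    rw [norm_mul]
    gcongr
  rw [e, partialDeriv_cauchyIntegral hμ hxk.le (hh.const_mul c) hC' i hz, cauchyDeriv]
  simp_rw [mul_assoc]
  rw [cauchyIntegral_const_mul, hc]
  push_cast
  rw [← add_assoc, Real.Gamma_add_one hxk.ne']
  push_cast
  ring

theorem ae_norm_mul_conj_coord_le (hμ : ∀ᵐ w ∂μ, w ∈ unitBall n) {C : ℝ} {h : Cn n → ℂ}
    (hC : ∀ᵐ w ∂μ, ‖h w‖ ≤ C) (i : Fin n) (p : ℕ) : ∀ᵐ w ∂μ, ‖h w * conj (w i) ^ p‖ ≤ C := by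
  filter_upwards [hμ, hC] with w hw hCw
  have hwi : ‖w i‖ ≤ 1 := (PiLp.norm_apply_le w i).trans (mem_ball_zero_iff.1 hw).le
  rw [norm_mul, norm_pow, RCLike.norm_conj]
  exact (mul_le_of_le_one_right (norm_nonneg _) (pow_le_one₀ (norm_nonneg _) hwi)).trans hCw

theorem aestronglyMeasurable_mul_conj_coord {h : Cn n → ℂ}
    (hh : AEStronglyMeasurable h μ) (i : Fin n) (p : ℕ) :
    AEStronglyMeasurable (fun w => h w * conj (w i) ^ p) μ := by
  refine hh.mul (Continuous.aestronglyMeasurable ?_)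
  fun_prop

/-- Agreement on the ball suffices at each stage, because the ball is open and partial derivatives
are local. -/
theorem iterate_partialDeriv_cauchyDeriv [IsFiniteMeasure μ] (hμ : ∀ᵐ w ∂μ, w ∈ unitBall n) (hx : 0 < x)
    {k : ℕ} {C : ℝ} {h F : Cn n → ℂ}
    (hh : AEStronglyMeasurable h μ) (hC : ∀ᵐ w ∂μ, ‖h w‖ ≤ C)
    (hF : Set.EqOn F (cauchyDeriv μ x k h) (unitBall n)) (i : Fin n) (p : ℕ) :
    Set.EqOn ((partialDeriv i)^[p] F)
      (cauchyDeriv μ x (k + p) fun w => h w * conj (w i) ^ p) (unitBall n) := by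
  induction p with
  | zero => simpa using hF
  | succ p ih =>
    rw [Function.iterate_succ_apply']
    intro z hz
    rw [partialDeriv_congr ih i hz, partialDeriv_cauchyDeriv hμ hx _
      (aestronglyMeasurable_mul_conj_coord hh i p) (ae_norm_mul_conj_coord_le hμ hC i p) i hz]
    simp_rw [mul_assoc, ← pow_succ]
    rw [← add_assoc]

/-- Measurability and the bound by `C` are carried through the induction, since the density after
each stage is what the next stage differentiates. -/
theorem foldr_partialDeriv_cauchyDeriv [IsFiniteMeasure μ] (hμ : ∀ᵐ w ∂μ, w ∈ unitBall n) (hx : 0 < x)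
    {C : ℝ} {h : Cn n → ℂ} (hh : AEStronglyMeasurable h μ) (hC : ∀ᵐ w ∂μ, ‖h w‖ ≤ C)
    (m : Fin n → ℕ) (l : List (Fin n)) :
    AEStronglyMeasurable (fun w => h w * (l.map fun i => conj (w i) ^ m i).prod) μ ∧
    (∀ᵐ w ∂μ, ‖h w * (l.map fun i => conj (w i) ^ m i).prod‖ ≤ C) ∧
    Set.EqOn (l.foldr (fun i F => (partialDeriv i)^[m i] F) (cauchyDeriv μ x 0 h))
      (cauchyDeriv μ x (l.map m).sum fun w => h w * (l.map fun i => conj (w i) ^ m i).prod)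
      (unitBall n) := by
  induction l with
  | nil => simpa using ⟨hh, hC, Set.eqOn_refl _ _⟩
  | cons i l ih =>
    obtain ⟨ih1, ih2, ih3⟩ := ih
    have e : ∀ w : Cn n, h w * ((i :: l).map fun i => conj (w i) ^ m i).prod =
        h w * (l.map fun i => conj (w i) ^ m i).prod * conj (w i) ^ m i := by
      intro w
      rw [List.map_cons, List.prod_cons]
      ring
    simp_rw [e]
    refine ⟨aestronglyMeasurable_mul_conj_coord ih1 i (m i),
      ae_norm_mul_conj_coord_le hμ ih2 i (m i), ?_⟩
    rw [List.foldr_cons, List.map_cons, List.sum_cons, add_comm]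
    exact iterate_partialDeriv_cauchyDeriv hμ hx ih1 ih2 ih3 i (m i)

theorem multiDeriv_cauchyIntegral [IsFiniteMeasure μ] (hμ : ∀ᵐ w ∂μ, w ∈ unitBall n) (hx : 0 < x)
    {C : ℝ} {h : Cn n → ℂ} (hh : AEStronglyMeasurable h μ) (hC : ∀ᵐ w ∂μ, ‖h w‖ ≤ C)
    (m : Fin n → ℕ) {z : Cn n} (hz : z ∈ unitBall n) :
    multiDeriv m (cauchyIntegral μ x h) z =
      cauchyDeriv μ x (∑ i, m i) (fun w => h w * ∏ i, conj (w i) ^ m i) z := by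
  have h0 : cauchyDeriv μ x 0 h = cauchyIntegral μ x h := by
    ext z
    rw [cauchyDeriv, Nat.cast_zero, add_zero, div_self (Real.Gamma_pos_of_pos hx).ne']
    simp
  have h1 := (foldr_partialDeriv_cauchyDeriv hμ hx hh hC m (List.finRange n)).2.2 hz
  rw [h0] at h1
  rw [multiDeriv, h1, ← List.ofFn_eq_map, List.sum_ofFn]
  simp_rw [← List.ofFn_eq_map, List.prod_ofFn]

end

/-! ### Derivatives of the Bergman projection -/

theorem bergmanProj_eq_cauchyIntegral {n : ℕ} (α : ℝ) (g : LInfty n) :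
    bergmanProj n α g = cauchyIntegral (weightedMeasure n α) (n + 1 + α) g := by
  ext z
  rw [bergmanProj, cauchyIntegral]
  congr 1
  ext w
  rw [bergmanKernel, one_div, ← Complex.cpow_neg, mul_comm]
  push_cast
  rfl

theorem aestronglyMeasurable_LInfty {n : ℕ} (α : ℝ) (g : LInfty n) :
    AEStronglyMeasurable g (weightedMeasure n α) :=
  (Lp.aestronglyMeasurable g).mono_ac (weightedMeasure_absolutelyContinuous n α)

theorem ae_norm_le_LInfty {n : ℕ} (α : ℝ) (g : LInfty n) :
    ∀ᵐ w ∂weightedMeasure n α, ‖g w‖ ≤ ‖g‖ := by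
  refine (weightedMeasure_absolutelyContinuous n α).ae_le ?_
  have h := ae_le_eLpNormEssSup (f := g) (μ := ballMeasure n)
  filter_upwards [h] with w hw
  rw [Lp.norm_def, eLpNorm_exponent_top]
  have h2 := ENNReal.toReal_mono (by
    rw [← eLpNorm_exponent_top]
    exact Lp.eLpNorm_ne_top g) hw
  simpa using h2

theorem multiDeriv_bergmanProj {n : ℕ} {α : ℝ} (hn : 1 ≤ n) (hα : -1 < α) (g : LInfty n)
    (m : Fin n → ℕ) {z : Cn n} (hz : z ∈ unitBall n) :
    multiDeriv m (bergmanProj n α g) z =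
      cauchyDeriv (weightedMeasure n α) (n + 1 + α) (∑ i, m i)
        (fun w => g w * ∏ i, conj (w i) ^ m i) z := by
  have := isProbabilityMeasure_weightedMeasure n hα
  have hx := one_lt_dim_add_one_add hn hα
  rw [bergmanProj_eq_cauchyIntegral]
  exact multiDeriv_cauchyIntegral (ae_mem_unitBall n α) (by linarith)
    (aestronglyMeasurable_LInfty α g) (ae_norm_le_LInfty α g) m hz

/-! ### The upper bound -/

/-- Log-convexity: `a + 1/2` and `b` are convex combinations of `a` and `b + 1/2` with exchanged
weights `t`, `1 - t`, so multiplying the two inequalities gives exponents that add up to one. -/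
theorem Gamma_add_half_mul_le {a b : ℝ} (ha : 0 < a) (hab : a ≤ b) :
    Real.Gamma (a + 1 / 2) * Real.Gamma b ≤ Real.Gamma a * Real.Gamma (b + 1 / 2) := by
  rcases hab.eq_or_lt with rfl | hlt
  · rw [mul_comm]
  set t := (1 / 2) / (b + 1 / 2 - a) with ht
  have hd : 0 < b + 1 / 2 - a := by linarith
  have ht0 : 0 < t := by positivity
  have ht1 : 0 < 1 - t := by
    rw [ht, sub_pos, div_lt_one hd]
    linarith
  have htd : t * (b + 1 / 2 - a) = 1 / 2 := div_mul_cancel₀ _ hd.ne'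
  have hb : 0 < b + 1 / 2 := by linarith
  have h1 := Real.Gamma_mul_add_mul_le_rpow_Gamma_mul_rpow_Gamma ha hb ht1 ht0 (by ring)
  have h2 := Real.Gamma_mul_add_mul_le_rpow_Gamma_mul_rpow_Gamma ha hb ht0 ht1 (by ring)
  rw [show (1 - t) * a + t * (b + 1 / 2) = a + 1 / 2 by linarith] at h1
  rw [show t * a + (1 - t) * (b + 1 / 2) = b by linarith] at h2
  have hGa := Real.Gamma_pos_of_pos ha
  have hGb := Real.Gamma_pos_of_pos hb
  have h3 := mul_le_mul h1 h2 (Real.Gamma_pos_of_pos (ha.trans hlt)).le (by positivity)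
  refine h3.trans_eq ?_
  rw [mul_mul_mul_comm, ← Real.rpow_add hGa, mul_comm (Real.Gamma (b + 1 / 2) ^ t),
    mul_comm (Real.Gamma a ^ _), ← Real.rpow_add hGb]
  simp
  ring

/-- The maximal value of `|∂^m P g (0)|` over `|m| = k` and `‖g‖ ≤ 1`. -/
noncomputable def momentConst (x : ℝ) (k : ℕ) : ℝ :=
  Real.Gamma (x + k) * Real.Gamma ((k : ℝ) / 2 + 1) / Real.Gamma (x + (k : ℝ) / 2)

/-- With `p = k/2 + 1 ≤ y = x + k/2`, log-convexity bounds the ratio of consecutive terms below by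
`p (x + k) / y`, and this is at least one. -/
theorem momentConst_mono {x : ℝ} (hx : 1 ≤ x) : Monotone (momentConst x) := by
  refine monotone_nat_of_le_succ fun k => ?_
  have hk : (0 : ℝ) ≤ k := Nat.cast_nonneg k
  set p : ℝ := (k : ℝ) / 2 + 1 with hp
  set y : ℝ := x + (k : ℝ) / 2 with hy
  have hp0 : 0 < p := by positivity
  have hy0 : 0 < y := by positivity
  have hpy : p ≤ y := by linarith
  have hxk : 0 < x + k := by positivity
  -- The shift by one half makes both sides comparable through the recursion for `Γ(p + 1)` and `Γ(y
  -- + 1)`.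
  have h1 := Gamma_add_half_mul_le (a := p + 1 / 2) (b := y + 1 / 2) (by linarith) (by linarith)
  rw [show p + 1 / 2 + 1 / 2 = p + 1 by ring, show y + 1 / 2 + 1 / 2 = y + 1 by ring,
    Real.Gamma_add_one hp0.ne', Real.Gamma_add_one hy0.ne'] at h1
  have hGp := Real.Gamma_pos_of_pos hp0
  have hGy := Real.Gamma_pos_of_pos hy0
  have hGp' := Real.Gamma_pos_of_pos (show 0 < p + 1 / 2 by linarith)
  have hGy' := Real.Gamma_pos_of_pos (show 0 < y + 1 / 2 by linarith)
  have hGx := Real.Gamma_pos_of_pos hxk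
  have h2 : y ≤ p * (x + k) := by
    rw [hy, hp]
    nlinarith
  have h3 : Real.Gamma p * Real.Gamma (y + 1 / 2) ≤
      (x + k) * (Real.Gamma (p + 1 / 2) * Real.Gamma y) := by
    have h4 : p * (Real.Gamma p * Real.Gamma (y + 1 / 2)) ≤
        p * ((x + k) * (Real.Gamma (p + 1 / 2) * Real.Gamma y)) := by
      calc p * (Real.Gamma p * Real.Gamma (y + 1 / 2))
          ≤ y * (Real.Gamma (p + 1 / 2) * Real.Gamma y) := by linarith
        _ ≤ p * (x + k) * (Real.Gamma (p + 1 / 2) * Real.Gamma y) := by gcongr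
        _ = _ := by ring
    exact le_of_mul_le_mul_left h4 hp0
  rw [momentConst, momentConst]
  push_cast
  rw [show x + ((k : ℝ) + 1) = x + k + 1 by ring, show ((k : ℝ) + 1) / 2 + 1 = p + 1 / 2 by
    rw [hp]; ring, show x + ((k : ℝ) + 1) / 2 = y + 1 / 2 by rw [hy]; ring,
    Real.Gamma_add_one hxk.ne', div_le_div_iff₀ hGy hGy']
  calc Real.Gamma (x + k) * Real.Gamma p * Real.Gamma (y + 1 / 2)
      = Real.Gamma (x + k) * (Real.Gamma p * Real.Gamma (y + 1 / 2)) := by ring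
    _ ≤ Real.Gamma (x + k) * ((x + k) * (Real.Gamma (p + 1 / 2) * Real.Gamma y)) := by gcongr
    _ = _ := by ring

theorem prod_pow_le_weighted_sum {n : ℕ} (m : Fin n → ℕ) (hm : 0 < ∑ i, m i) {a : Fin n → ℝ}
    (ha : ∀ i, 0 ≤ a i) :
    ∏ i, a i ^ m i ≤ ∑ i, (m i : ℝ) / (∑ i, m i : ℕ) * a i ^ (∑ i, m i) := by
  have hk : (0 : ℝ) < (∑ i, m i : ℕ) := by exact_mod_cast hm
  have h := Real.geom_mean_le_arith_mean_weighted Finset.univ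
    (fun i => (m i : ℝ) / (∑ i, m i : ℕ)) (fun i => a i ^ (∑ i, m i)) (fun i _ => by positivity)
    (by rw [← Finset.sum_div, ← Nat.cast_sum, div_self hk.ne']) (fun i _ => pow_nonneg (ha i) _)
  refine le_trans (le_of_eq ?_) h
  refine Finset.prod_congr rfl fun i _ => ?_
  rw [← Real.rpow_natCast (a i) (∑ i, m i), ← Real.rpow_mul (ha i), mul_div_cancel₀ _ hk.ne',
    Real.rpow_natCast]

/-- Weighted AM-GM with weights `m_i / |m|` bounds the product by an average of `|w_i|^|m|`, and all
coordinates have the same law. Pure powers of one coordinate are thus extremal. -/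
theorem lintegral_prod_norm_pow_le {n : ℕ} {α : ℝ} (hn : 1 ≤ n) (hα : -1 < α) (m : Fin n → ℕ) :
    ∫⁻ w : Cn n, ENNReal.ofReal (∏ i, ‖w i‖ ^ m i) ∂weightedMeasure n α ≤
      ENNReal.ofReal (Real.Gamma (n + 1 + α) * Real.Gamma ((∑ i, m i : ℕ) / 2 + 1) /
        Real.Gamma (n + 1 + α + (∑ i, m i : ℕ) / 2)) := by
  have hx := one_lt_dim_add_one_add hn hα
  rw [← lintegral_norm_rpow_discMeasure hx (Nat.cast_nonneg _)]
  rcases Nat.eq_zero_or_pos (∑ i, m i) with h0 | hpos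
  · have hm : ∀ i, m i = 0 := fun i => Finset.sum_eq_zero_iff.1 h0 i (Finset.mem_univ i)
    have := isProbabilityMeasure_weightedMeasure n hα
    have := isProbabilityMeasure_discMeasure (show -1 < (n : ℝ) + 1 + α - 2 by linarith)
    simp [hm]
  simp_rw [Real.rpow_natCast]
  have hk : (0 : ℝ) < (∑ i, m i : ℕ) := by exact_mod_cast hpos
  calc ∫⁻ w : Cn n, ENNReal.ofReal (∏ i, ‖w i‖ ^ m i) ∂weightedMeasure n α
      ≤ ∫⁻ w : Cn n, ∑ i, ENNReal.ofReal ((m i : ℝ) / (∑ i, m i : ℕ)) *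
          ENNReal.ofReal (‖w i‖ ^ (∑ i, m i)) ∂weightedMeasure n α := by
        refine lintegral_mono fun w => ?_
        refine (ENNReal.ofReal_le_ofReal
          (prod_pow_le_weighted_sum m hpos fun i => norm_nonneg (w i))).trans_eq ?_
        rw [ENNReal.ofReal_sum_of_nonneg fun i _ => by positivity]
        exact Finset.sum_congr rfl fun i _ => ENNReal.ofReal_mul (by positivity)
    _ = ∑ i, ENNReal.ofReal ((m i : ℝ) / (∑ i, m i : ℕ)) *
          ∫⁻ ζ, ENNReal.ofReal (‖ζ‖ ^ (∑ i, m i)) ∂discMeasure (n + 1 + α - 2) := by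
        rw [lintegral_finsetSum _ fun i _ => by fun_prop]
        refine Finset.sum_congr rfl fun i _ => ?_
        rw [lintegral_const_mul _ (by fun_prop), lintegral_coord_weightedMeasure hα i
          (F := fun ζ => ENNReal.ofReal (‖ζ‖ ^ (∑ i, m i))) (by fun_prop)]
    _ = _ := by
        rw [← Finset.sum_mul, ← ENNReal.ofReal_sum_of_nonneg fun i _ => by positivity,
          ← Finset.sum_div, ← Nat.cast_sum, div_self hk.ne', ENNReal.ofReal_one, one_mul]

theorem ofReal_norm_cauchyDeriv_le {n : ℕ} {μ : Measure (Cn n)} {x : ℝ} (hx : 0 < x) (k : ℕ)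
    (h : Cn n → ℂ) (z : Cn n) :
    ENNReal.ofReal ‖cauchyDeriv μ x k h z‖ ≤
      ENNReal.ofReal (Real.Gamma (x + k) / Real.Gamma x) *
        ∫⁻ w, ENNReal.ofReal (‖h w‖ * ‖1 - inner ℂ w z‖ ^ (-(x + k))) ∂μ := by
  have hG : 0 ≤ Real.Gamma (x + k) / Real.Gamma x :=
    div_nonneg (Real.Gamma_pos_of_pos (by positivity)).le (Real.Gamma_pos_of_pos hx).le
  rw [cauchyDeriv, norm_mul, Complex.norm_real, Real.norm_of_nonneg hG, ENNReal.ofReal_mul hG]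
  gcongr
  rw [cauchyIntegral, ofReal_norm]
  refine (enorm_integral_le_lintegral_enorm _).trans_eq ?_
  refine lintegral_congr fun w => ?_
  rw [← ofReal_norm, norm_mul, norm_one_sub_inner_cpow]

theorem norm_mul_prod_conj {n : ℕ} (a : ℂ) (m : Fin n → ℕ) (w : Cn n) :
    ‖a * ∏ i, conj (w i) ^ m i‖ = ‖a‖ * ∏ i, ‖w i‖ ^ m i := by
  simp [norm_prod]

/-- At `z = 0` the kernel is `1`, so only the moment of the monomial remains. -/
theorem ofReal_norm_multiDeriv_zero_le {n : ℕ} {α : ℝ} (hn : 1 ≤ n) (hα : -1 < α) {g : LInfty n}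
    (hg : ‖g‖ ≤ 1) (m : Fin n → ℕ) :
    ENNReal.ofReal ‖multiDeriv m (bergmanProj n α g) 0‖ ≤
      ENNReal.ofReal (momentConst (n + 1 + α) (∑ i, m i)) := by
  have hx := one_lt_dim_add_one_add hn hα
  have hGx := Real.Gamma_pos_of_pos (show 0 < (n : ℝ) + 1 + α by linarith)
  have hG2 := Real.Gamma_pos_of_pos (show 0 < (n : ℝ) + 1 + α + (∑ i, m i : ℕ) by positivity)
  rw [multiDeriv_bergmanProj hn hα g m (mem_ball_self one_pos)]
  refine (ofReal_norm_cauchyDeriv_le (by linarith) _ _ _).trans ?_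
  calc _ ≤ ENNReal.ofReal (Real.Gamma (n + 1 + α + (∑ i, m i : ℕ)) / Real.Gamma (n + 1 + α)) *
        ∫⁻ w : Cn n, ENNReal.ofReal (∏ i, ‖w i‖ ^ m i) ∂weightedMeasure n α := by
        refine mul_le_mul_right (lintegral_mono_ae ?_) _
        filter_upwards [ae_norm_le_LInfty α g] with w hw
        rw [norm_mul_prod_conj, inner_zero_right, sub_zero, norm_one, Real.one_rpow, mul_one]
        refine ENNReal.ofReal_le_ofReal (mul_le_of_le_one_left ?_ (hw.trans hg))
        exact Finset.prod_nonneg fun i _ => by positivity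
    _ ≤ _ := mul_le_mul_right (lintegral_prod_norm_pow_le hn hα m) _
    _ = _ := by
        rw [← ENNReal.ofReal_mul (div_pos hG2 hGx).le, momentConst]
        congr 1
        field_simp

/-- The sharp constant in the bound of the Bloch seminorm. -/
noncomputable def seminormConst (x : ℝ) (N : ℕ) : ℝ :=
  Real.Gamma (x + N) * Real.Gamma N / Real.Gamma ((x + N) / 2) ^ 2

theorem ofReal_norm_cauchyDeriv_mul_le {n N : ℕ} {α C : ℝ} (hn : 1 ≤ n) (hN : 1 ≤ N) (hα : -1 < α)
    (hC0 : 0 ≤ C) {h : Cn n → ℂ} (hC : ∀ᵐ w ∂weightedMeasure n α, ‖h w‖ ≤ C) {z : Cn n} (hz : z ∈ unitBall n) :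
    ENNReal.ofReal ((1 - ‖z‖ ^ 2) ^ N *
        ‖cauchyDeriv (weightedMeasure n α) (n + 1 + α) N h z‖) ≤
      ENNReal.ofReal (C * seminormConst (n + 1 + α) N) := by
  have hx := one_lt_dim_add_one_add hn hα
  have hGx := Real.Gamma_pos_of_pos (show 0 < (n : ℝ) + 1 + α by linarith)
  have hG2 := Real.Gamma_pos_of_pos (show 0 < (n : ℝ) + 1 + α + N by positivity)
  have hN0 : (0 : ℝ) < N := by exact_mod_cast hN
  have hz' := mem_ball_zero_iff.1 hz
  have hA : 0 < 1 - ‖z‖ ^ 2 := by nlinarith [norm_nonneg z]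
  have h1 := ofReal_norm_cauchyDeriv_le (μ := weightedMeasure n α) (show 0 < (n : ℝ) + 1 + α by linarith) N h z
  have h2 := lintegral_norm_one_sub_inner_rpow_le hn hα hN0 hz
  rw [Real.rpow_natCast] at h2
  have hm : Measurable fun w : Cn n =>
      ENNReal.ofReal (‖1 - inner ℂ w z‖ ^ (-((n : ℝ) + 1 + α + N))) := by
    have : Measurable fun w : Cn n => 1 - inner ℂ w z :=
      (continuous_const.sub (continuous_id.inner continuous_const)).measurable
    fun_prop
  have h3 : ∫⁻ w, ENNReal.ofReal (‖h w‖ * ‖1 - inner ℂ w z‖ ^ (-((n : ℝ) + 1 + α + N)))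
      ∂weightedMeasure n α ≤ ENNReal.ofReal C *
        ∫⁻ w, ENNReal.ofReal (‖1 - inner ℂ w z‖ ^ (-((n : ℝ) + 1 + α + N))) ∂weightedMeasure n α := by
    rw [← lintegral_const_mul _ hm]
    refine lintegral_mono_ae ?_
    filter_upwards [hC] with w hw
    rw [← ENNReal.ofReal_mul hC0]
    gcongr
  rw [ENNReal.ofReal_mul (by positivity)]
  calc _ ≤ ENNReal.ofReal ((1 - ‖z‖ ^ 2) ^ N) *
        (ENNReal.ofReal (Real.Gamma (n + 1 + α + N) / Real.Gamma (n + 1 + α)) *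
          (ENNReal.ofReal C * ∫⁻ w, ENNReal.ofReal (‖1 - inner ℂ w z‖ ^ (-((n : ℝ) + 1 + α + N)))
            ∂weightedMeasure n α)) := by
        gcongr
        exact h1.trans (by gcongr)
    _ = ENNReal.ofReal C * ENNReal.ofReal (Real.Gamma (n + 1 + α + N) / Real.Gamma (n + 1 + α)) *
        (ENNReal.ofReal ((1 - ‖z‖ ^ 2) ^ N) *
          ∫⁻ w, ENNReal.ofReal (‖1 - inner ℂ w z‖ ^ (-((n : ℝ) + 1 + α + N)))
            ∂weightedMeasure n α) := by ring
    _ ≤ _ := mul_le_mul_right h2 _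
    _ = _ := by
        rw [← ENNReal.ofReal_mul hC0, ← ENNReal.ofReal_mul (mul_nonneg hC0 (div_pos hG2 hGx).le),
          seminormConst]
        congr 1
        field_simp

theorem ae_norm_mul_prod_conj_le {n : ℕ} (α : ℝ) (g : LInfty n) (m : Fin n → ℕ) :
    ∀ᵐ w ∂weightedMeasure n α, ‖g w * ∏ i, conj (w i) ^ m i‖ ≤ ‖g‖ := by
  filter_upwards [ae_norm_le_LInfty α g, ae_mem_unitBall n α] with w hw hb
  rw [norm_mul_prod_conj]
  refine (mul_le_of_le_one_right (norm_nonneg _) ?_).trans hw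
  refine Finset.prod_le_one (fun i _ => by positivity) fun i _ => pow_le_one₀ (norm_nonneg _) ?_
  exact (PiLp.norm_apply_le w i).trans (mem_ball_zero_iff.1 hb).le

theorem blochNorm_bergmanProj_le {n N : ℕ} {α : ℝ} (hn : 1 ≤ n) (hN : 1 ≤ N) (hα : -1 < α)
    {g : LInfty n} (hg : ‖g‖ ≤ 1) :
    blochNorm N (bergmanProj n α g) ≤ ENNReal.ofReal (momentConst (n + 1 + α) (N - 1)) +
      ENNReal.ofReal (seminormConst (n + 1 + α) N) := by
  have hx := one_lt_dim_add_one_add hn hα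
  refine add_le_add (iSup₂_le fun m hm => ?_) (iSup₂_le fun m hm => iSup₂_le fun z hz => ?_)
  · exact (ofReal_norm_multiDeriv_zero_le hn hα hg m).trans
      (ENNReal.ofReal_le_ofReal (momentConst_mono hx.le hm))
  · rw [multiDeriv_bergmanProj hn hα g m hz, hm]
    have h := ofReal_norm_cauchyDeriv_mul_le hn hN hα zero_le_one
      ((ae_norm_mul_prod_conj_le α g m).mono fun w hw => hw.trans hg) hz
    rwa [one_mul] at h

theorem isBloch_bergmanProj {n : ℕ} {α : ℝ} (hn : 1 ≤ n) (hα : -1 < α) (g : LInfty n) :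
    IsBloch (bergmanProj n α g) := by
  have := isProbabilityMeasure_weightedMeasure n hα
  have hx := one_lt_dim_add_one_add hn hα
  have hx0 : 0 < (n : ℝ) + 1 + α := by linarith
  have hμ := ae_mem_unitBall n α
  have hm := aestronglyMeasurable_LInfty α g
  have hC := ae_norm_le_LInfty α g
  rw [bergmanProj_eq_cauchyIntegral]
  refine ⟨fun z hz => (hasFDerivAt_cauchyIntegral hμ hx0.le hm hC hz).2.differentiableAt.differentiableWithinAt,
    ∑ _i : Fin n, ‖g‖ * seminormConst (n + 1 + α) 1, fun z hz => ?_⟩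
  have hz' := mem_ball_zero_iff.1 hz
  have hA : 0 < 1 - ‖z‖ ^ 2 := by nlinarith [norm_nonneg z]
  have hS : 0 ≤ seminormConst (n + 1 + α) 1 := by
    have := Real.Gamma_pos_of_pos (show 0 < (n : ℝ) + 1 + α + (1 : ℕ) by positivity)
    have := Real.Gamma_pos_of_pos (show 0 < ((1 : ℕ) : ℝ) by simp)
    unfold seminormConst
    positivity
  have hi : ∀ i, (1 - ‖z‖ ^ 2) *
      ‖partialDeriv i (cauchyIntegral (weightedMeasure n α) (n + 1 + α) g) z‖ ≤
      ‖g‖ * seminormConst (n + 1 + α) 1 := by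
    intro i
    have h0 : cauchyDeriv (weightedMeasure n α) (n + 1 + α) 0 g =
        cauchyIntegral (weightedMeasure n α) (n + 1 + α) g := by
      ext z
      rw [cauchyDeriv, Nat.cast_zero, add_zero, div_self (Real.Gamma_pos_of_pos hx0).ne']
      simp
    have hC1 := ae_norm_mul_conj_coord_le hμ hC i 1
    simp only [pow_one] at hC1
    have h1 := ofReal_norm_cauchyDeriv_mul_le hn le_rfl hα (norm_nonneg g) hC1 hz
    rw [← h0, partialDeriv_cauchyDeriv hμ hx0 0 hm hC i hz]
    rwa [pow_one, ENNReal.ofReal_le_ofReal_iff (by positivity)] at h1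
  set v : Fin n → ℂ := fun i =>
    partialDeriv i (cauchyIntegral (weightedMeasure n α) (n + 1 + α) g) z with hv
  -- Only finiteness is needed here, so the Euclidean norm of the gradient is bounded crudely by the
  -- sum of its entries.
  have hnorm : ‖(WithLp.toLp 2 v : Cn n)‖ ≤ ∑ i, ‖v i‖ := by
    rw [EuclideanSpace.norm_eq]
    refine Real.sqrt_le_iff.2 ⟨Finset.sum_nonneg fun i _ => norm_nonneg _, ?_⟩
    exact Finset.sum_sq_le_sq_sum_of_nonneg fun i _ => norm_nonneg _
  calc (1 - ‖z‖ ^ 2) * ‖(WithLp.toLp 2 v : Cn n)‖ ≤ (1 - ‖z‖ ^ 2) * ∑ i, ‖v i‖ := by gcongr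
    _ = ∑ i, (1 - ‖z‖ ^ 2) * ‖v i‖ := Finset.mul_sum _ _ _
    _ ≤ _ := Finset.sum_le_sum fun i _ => hi i

/-! ### Extremal functions and the lower bound -/

/-- The kernel representing `∂^k/∂z_i^k` of the Bergman projection at the point `r e_i`, as a
function of the `i`-th coordinate. -/
noncomputable def derivKernel (x : ℝ) (k : ℕ) (r : ℝ) (ζ : ℂ) : ℂ :=
  ((Real.Gamma (x + k) / Real.Gamma x : ℝ) : ℂ) *
    (conj ζ ^ k * (1 - (r : ℂ) * conj ζ) ^ (-((x + k : ℝ) : ℂ)))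

theorem measurable_derivKernel (x : ℝ) (k : ℕ) (r : ℝ) : Measurable (derivKernel x k r) := by
  have : Measurable fun ζ : ℂ => conj ζ := Complex.continuous_conj.measurable
  unfold derivKernel
  fun_prop

theorem norm_derivKernel {x : ℝ} (hx : 0 < x) (k : ℕ) (r : ℝ) (ζ : ℂ) :
    ‖derivKernel x k r ζ‖ =
      Real.Gamma (x + k) / Real.Gamma x * (‖ζ‖ ^ k * ‖1 - (r : ℂ) * ζ‖ ^ (-(x + k))) := by
  have hG : 0 ≤ Real.Gamma (x + k) / Real.Gamma x :=
    div_nonneg (Real.Gamma_pos_of_pos (by positivity)).le (Real.Gamma_pos_of_pos hx).le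
  have h : ‖1 - (r : ℂ) * conj ζ‖ = ‖1 - (r : ℂ) * ζ‖ := by
    rw [← RCLike.norm_conj]
    simp
  rw [derivKernel, norm_mul, norm_mul, norm_pow, RCLike.norm_conj, Complex.norm_real,
    Real.norm_of_nonneg hG, ← Complex.ofReal_neg, Complex.norm_cpow_real, h]

theorem norm_single_ofReal {n : ℕ} (i : Fin n) {r : ℝ} (h0 : 0 ≤ r) :
    ‖EuclideanSpace.single i (r : ℂ)‖ = r := by
  rw [PiLp.norm_single, Complex.norm_real, Real.norm_of_nonneg h0]

theorem single_ofReal_mem_unitBall {n : ℕ} (i : Fin n) {r : ℝ} (h0 : 0 ≤ r) (h1 : r < 1) :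
    EuclideanSpace.single i (r : ℂ) ∈ unitBall n := by
  rwa [unitBall, mem_ball_zero_iff, norm_single_ofReal i h0]

theorem multiDeriv_single_bergmanProj {n : ℕ} {α : ℝ} (hn : 1 ≤ n) (hα : -1 < α) (g : LInfty n)
    (i : Fin n) (k : ℕ) {r : ℝ} (h0 : 0 ≤ r) (h1 : r < 1) :
    multiDeriv (Pi.single i k) (bergmanProj n α g) (EuclideanSpace.single i (r : ℂ)) =
      ∫ w, g w * derivKernel (n + 1 + α) k r (w i) ∂weightedMeasure n α := by
  have hz := single_ofReal_mem_unitBall i h0 h1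
  have hsum : ∑ j, (Pi.single i k : Fin n → ℕ) j = k := by simp
  have hprod : ∀ w : Cn n, ∏ j, conj (w j) ^ (Pi.single i k : Fin n → ℕ) j = conj (w i) ^ k := by
    intro w
    rw [Fintype.prod_eq_single i fun j hj => by rw [Pi.single_eq_of_ne hj, pow_zero],
      Pi.single_eq_same]
  rw [multiDeriv_bergmanProj hn hα g _ hz, hsum, cauchyDeriv, cauchyIntegral, ← integral_const_mul]
  congr 1
  ext w
  rw [hprod, EuclideanSpace.inner_single_right, derivKernel]
  ring

theorem lintegral_derivKernel_zero {x : ℝ} (hx : 1 < x) (k : ℕ) :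
    ∫⁻ ζ, ENNReal.ofReal ‖derivKernel x k 0 ζ‖ ∂discMeasure (x - 2) =
      ENNReal.ofReal (momentConst x k) := by
  have hx0 : 0 < x := by linarith
  have hGx := Real.Gamma_pos_of_pos hx0
  have hG2 := Real.Gamma_pos_of_pos (show 0 < x + k by positivity)
  have e : ∀ ζ, ENNReal.ofReal ‖derivKernel x k 0 ζ‖ =
      ENNReal.ofReal (Real.Gamma (x + k) / Real.Gamma x) * ENNReal.ofReal (‖ζ‖ ^ (k : ℝ)) := by
    intro ζ
    rw [norm_derivKernel hx0, ← ENNReal.ofReal_mul (by positivity)]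
    simp
  simp_rw [e]
  rw [lintegral_const_mul _ (by fun_prop), lintegral_norm_rpow_discMeasure hx (Nat.cast_nonneg k),
    ← ENNReal.ofReal_mul (by positivity), momentConst]
  congr 1
  field_simp

theorem tendsto_lintegral_derivKernel {x : ℝ} (hx : 1 < x) {N : ℕ} (hN : 1 ≤ N) :
    Tendsto (fun r : ℝ => ∫⁻ ζ, ENNReal.ofReal ((1 - r ^ 2) ^ N * ‖derivKernel x N r ζ‖)
      ∂discMeasure (x - 2)) (𝓝[<] 1) (𝓝 (ENNReal.ofReal (seminormConst x N))) := by
  have hx0 : 0 < x := by linarith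
  have hN0 : (0 : ℝ) < N := by exact_mod_cast hN
  have hGx := Real.Gamma_pos_of_pos hx0
  have hG2 := Real.Gamma_pos_of_pos (show 0 < x + N by positivity)
  have h := ENNReal.Tendsto.const_mul (a := ENNReal.ofReal (Real.Gamma (x + N) / Real.Gamma x))
    (tendsto_lintegral_forelliRudin hx hN0 N) (Or.inr ENNReal.ofReal_ne_top)
  rw [← ENNReal.ofReal_mul (by positivity), show Real.Gamma (x + N) / Real.Gamma x *
    (Real.Gamma x * Real.Gamma N / Real.Gamma ((x + N) / 2) ^ 2) = seminormConst x N by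
      rw [seminormConst]; field_simp] at h
  refine h.congr' ?_
  filter_upwards [Ioo_mem_nhdsLT one_pos] with r hr
  have hA : 0 < 1 - r ^ 2 := by nlinarith [hr.1, hr.2]
  rw [Real.rpow_natCast, ← lintegral_const_mul' _ _ ENNReal.ofReal_ne_top,
    ← lintegral_const_mul' _ _ ENNReal.ofReal_ne_top]
  refine lintegral_congr fun ζ => ?_
  rw [norm_derivKernel hx0, ← ENNReal.ofReal_mul (by positivity), ← ENNReal.ofReal_mul (by positivity),
    ← ENNReal.ofReal_mul (by positivity)]
  congr 1
  ring

/-- The second kernel tends to `0` at each point of the open disc because of the factor `(1 -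
r²)^N`. The minimum is dominated by the fixed integrable kernel at the origin, although the second
kernel alone keeps its mass. -/
theorem tendsto_lintegral_min_derivKernel {x : ℝ} (hx : 1 < x) {N : ℕ} (hN : 1 ≤ N) (k : ℕ) :
    Tendsto (fun r : ℝ => ∫⁻ ζ, ENNReal.ofReal
        (min ‖derivKernel x k 0 ζ‖ ((1 - r ^ 2) ^ N * ‖derivKernel x N r ζ‖))
      ∂discMeasure (x - 2)) (𝓝[<] 1) (𝓝 0) := by
  have hx0 : 0 < x := by linarith
  have hm := fun k r => measurable_derivKernel x k r
  have hlim : Tendsto (fun r : ℝ => ∫⁻ ζ, ENNReal.ofReal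
        (min ‖derivKernel x k 0 ζ‖ ((1 - r ^ 2) ^ N * ‖derivKernel x N r ζ‖))
      ∂discMeasure (x - 2)) (𝓝[<] 1) (𝓝 (∫⁻ _, 0 ∂discMeasure (x - 2))) := by
    refine tendsto_lintegral_filter_of_dominated_convergence
      (fun ζ => ENNReal.ofReal ‖derivKernel x k 0 ζ‖) ?_ ?_ ?_ ?_
    · refine Eventually.of_forall fun r => ?_
      have := hm k 0
      have := hm N r
      fun_prop
    · refine Eventually.of_forall fun r => Eventually.of_forall fun ζ => ?_
      exact ENNReal.ofReal_le_ofReal (min_le_left _ _)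
    · rw [lintegral_derivKernel_zero hx]
      exact ENNReal.ofReal_ne_top
    · filter_upwards [ae_norm_lt_one_discMeasure (x - 2)] with ζ hζ
      refine tendsto_nhdsWithin_of_tendsto_nhds ?_
      have hc : ContinuousAt (fun r : ℝ => min ‖derivKernel x k 0 ζ‖
          ((1 - r ^ 2) ^ N * ‖derivKernel x N r ζ‖)) 1 := by
        refine continuousAt_const.min (ContinuousAt.mul (by fun_prop) ?_)
        simp_rw [norm_derivKernel hx0]
        refine continuousAt_const.mul (continuousAt_const.mul
          (ContinuousAt.rpow_const (by fun_prop) (Or.inl ?_)))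
        simpa using one_sub_ne_zero_of_norm_lt hζ
      have h2 := (ENNReal.continuous_ofReal.tendsto _).comp hc.tendsto
      have hN' : N ≠ 0 := by omega
      simpa [Function.comp_def, hN'] using h2
  simpa using hlim

/-- Every bounded measurable function of one coordinate is dual to a unimodular element of
`L^∞` that depends on that coordinate only. -/
theorem exists_LInfty_mul_eq_norm {n : ℕ} {α : ℝ} (i : Fin n) {K : ℂ → ℂ} (hK : Measurable K) :
    ∃ g : LInfty n, ‖g‖ ≤ 1 ∧ ∀ᵐ w ∂weightedMeasure n α, g w * K (w i) = (‖K (w i)‖ : ℂ) := by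
  -- Where `K` vanishes, division by zero gives `γ = 0`, and the required identity reads `0 = 0`.
  set γ : Cn n → ℂ := fun w => conj (K (w i)) / ‖K (w i)‖ with hγ
  have hKi : Measurable fun w : Cn n => K (w i) := hK.comp (by fun_prop)
  have hconj : Measurable fun ζ : ℂ => conj ζ := Complex.continuous_conj.measurable
  have hγm : Measurable γ := (hconj.comp hKi).div (by fun_prop)
  have hbound : ∀ w, ‖γ w‖ ≤ 1 := by
    intro w
    simp only [hγ, norm_div, RCLike.norm_conj, Complex.norm_real, norm_norm]
    exact div_self_le_one _
  have hle : eLpNorm γ ∞ (ballMeasure n) ≤ 1 := by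
    rw [eLpNorm_exponent_top]
    simpa using eLpNormEssSup_le_of_ae_bound (μ := ballMeasure n) (Eventually.of_forall hbound)
  have hmem : MemLp γ ∞ (ballMeasure n) :=
    ⟨hγm.aestronglyMeasurable, hle.trans_lt ENNReal.one_lt_top⟩
  refine ⟨hmem.toLp γ, ?_, ?_⟩
  · rw [Lp.norm_toLp]
    exact ENNReal.toReal_le_of_le_ofReal zero_le_one (by simpa using hle)
  · filter_upwards [(weightedMeasure_absolutelyContinuous n α).ae_le hmem.coeFn_toLp] with w hw
    rw [hw, hγ]
    simp only
    by_cases h0 : K (w i) = 0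
    · simp [h0]
    · have : (‖K (w i)‖ : ℂ) ≠ 0 := by simpa using h0
      rw [div_mul_eq_mul_div, mul_comm, Complex.mul_conj', div_eq_iff this]
      ring

theorem integrable_LInfty_mul_derivKernel {n : ℕ} {α : ℝ} (hn : 1 ≤ n) (hα : -1 < α)
    (g : LInfty n) (i : Fin n) (k : ℕ) {r : ℝ} (h0 : 0 ≤ r) (h1 : r < 1) :
    Integrable (fun w => g w * derivKernel (n + 1 + α) k r (w i)) (weightedMeasure n α) := by
  have := isProbabilityMeasure_weightedMeasure n hα
  have hx := one_lt_dim_add_one_add hn hα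
  have hz := single_ofReal_mem_unitBall i h0 h1
  have h := integrable_cauchyIntegrand (ae_mem_unitBall n α)
    (s := (n : ℝ) + 1 + α + k) (by positivity)
    (aestronglyMeasurable_mul_conj_coord (aestronglyMeasurable_LInfty α g) i k)
    (ae_norm_mul_conj_coord_le (ae_mem_unitBall n α) (ae_norm_le_LInfty α g) i k) hz
  refine (h.const_mul ((Real.Gamma (n + 1 + α + k) / Real.Gamma (n + 1 + α) : ℝ) : ℂ)).congr
    (Eventually.of_forall fun w => ?_)
  simp only
  rw [EuclideanSpace.inner_single_right, derivKernel]
  ring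

/-- For `g` dual to the combined kernel, the L¹ norm on the left equals `∂^(N-1)P_α g(0) + (1 -
r²)^N ∂^N P_α g(r e_i)`, both derivatives in `z_i`. Each summand is bounded by its own part of the
Bloch norm of this one function. -/
theorem lintegral_add_derivKernel_le_bergmanProjNorm {n N : ℕ} {α : ℝ} (hn : 1 ≤ n) (hα : -1 < α)
    {r : ℝ} (h0 : 0 ≤ r) (h1 : r < 1) :
    ∫⁻ ζ, ENNReal.ofReal ‖derivKernel (n + 1 + α) (N - 1) 0 ζ +
        ((1 - r ^ 2) ^ N : ℝ) * derivKernel (n + 1 + α) N r ζ‖ ∂discMeasure (n + 1 + α - 2) ≤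
      bergmanProjNorm n N α := by
  let i : Fin n := ⟨0, hn⟩
  have hA : 0 < 1 - r ^ 2 := by nlinarith
  set K : ℂ → ℂ := fun ζ => derivKernel (n + 1 + α) (N - 1) 0 ζ +
        ((1 - r ^ 2) ^ N : ℝ) * derivKernel (n + 1 + α) N r ζ with hK
  have hKm : Measurable K := (measurable_derivKernel _ _ _).add
    ((measurable_derivKernel _ _ _).const_mul _)
  obtain ⟨g, hg1, hg⟩ := exists_LInfty_mul_eq_norm (α := α) i hKm
  have hint0 := integrable_LInfty_mul_derivKernel hn hα g i (N - 1) le_rfl one_pos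
  have hintr := integrable_LInfty_mul_derivKernel hn hα g i N h0 h1
  have hd0 := multiDeriv_single_bergmanProj hn hα g i (N - 1) le_rfl one_pos
  have hdr := multiDeriv_single_bergmanProj hn hα g i N h0 h1
  have hz0 : EuclideanSpace.single i ((0 : ℝ) : ℂ) = 0 := by simp
  have hzn := norm_single_ofReal i h0
  have hzr := single_ofReal_mem_unitBall i h0 h1
  have hsum : ∀ k, ∑ j, (Pi.single i k : Fin n → ℕ) j = k := by simp
  have hgK : ∀ w, g w * K (w i) = g w * derivKernel (n + 1 + α) (N - 1) 0 (w i) +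
      ((1 - r ^ 2) ^ N : ℝ) * (g w * derivKernel (n + 1 + α) N r (w i)) := by
    intro w
    rw [hK]
    ring
  have hintK : Integrable (fun w => g w * K (w i)) (weightedMeasure n α) := by
    simp_rw [hgK]
    exact hint0.add (hintr.const_mul _)
  have hval : ∫ w, g w * K (w i) ∂weightedMeasure n α =
      multiDeriv (Pi.single i (N - 1)) (bergmanProj n α g) 0 + ((1 - r ^ 2) ^ N : ℝ) *
        multiDeriv (Pi.single i N) (bergmanProj n α g) (EuclideanSpace.single i (r : ℂ)) := by
    rw [← hz0, hd0, hdr, ← integral_const_mul, ← integral_add hint0 (hintr.const_mul _)]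
    simp_rw [hgK]
  have hnormK : Integrable (fun w : Cn n => ‖K (w i)‖) (weightedMeasure n α) := by
    refine (hintK.norm).congr ?_
    filter_upwards [hg] with w hw
    rw [hw, Complex.norm_real, norm_norm]
  have hval2 : ∫⁻ w, ENNReal.ofReal ‖K (w i)‖ ∂weightedMeasure n α =
      ENNReal.ofReal ‖∫ w, g w * K (w i) ∂weightedMeasure n α‖ := by
    rw [integral_congr_ae hg, integral_complex_ofReal, Complex.norm_real,
      Real.norm_of_nonneg (integral_nonneg fun _ => norm_nonneg _),
      ofReal_integral_eq_lintegral_ofReal hnormK (Eventually.of_forall fun _ => norm_nonneg _)]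
  rw [← lintegral_coord_weightedMeasure hα i (F := fun ζ => ENNReal.ofReal ‖K ζ‖) (by fun_prop),
    hval2, hval]
  refine le_trans ?_ (le_iSup₂ (f := fun (g : LInfty n) (_ : ‖g‖ ≤ 1) =>
    blochNorm N (bergmanProj n α g)) g hg1)
  refine (ENNReal.ofReal_le_ofReal (norm_add_le _ _)).trans ?_
  rw [ENNReal.ofReal_add (norm_nonneg _) (norm_nonneg _)]
  refine add_le_add ?_ ?_
  · exact le_iSup₂ (f := fun (m : Fin n → ℕ) (_ : ∑ i, m i ≤ N - 1) =>
      ENNReal.ofReal ‖multiDeriv m (bergmanProj n α g) 0‖) (Pi.single i (N - 1)) (hsum _).le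
  · rw [norm_mul, Complex.norm_real, Real.norm_of_nonneg (by positivity)]
    refine le_trans ?_ (le_iSup₂ (f := fun (m : Fin n → ℕ) (_ : ∑ i, m i = N) =>
      ⨆ (z : Cn n) (_ : z ∈ unitBall n),
        ENNReal.ofReal ((1 - ‖z‖ ^ 2) ^ N * ‖multiDeriv m (bergmanProj n α g) z‖))
      (Pi.single i N) (hsum N))
    refine le_trans (le_of_eq ?_) (le_iSup₂ (f := fun (z : Cn n) (_ : z ∈ unitBall n) =>
        ENNReal.ofReal ((1 - ‖z‖ ^ 2) ^ N *
          ‖multiDeriv (Pi.single i N) (bergmanProj n α g) z‖)) (EuclideanSpace.single i (r : ℂ)) hzr)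
    rw [hzn]

/-- The reverse triangle inequality, since `‖a‖ + ‖b‖` is `|‖a‖ - ‖b‖|` plus twice the minimum. -/
theorem norm_add_norm_le_norm_add_add_min (a b : ℂ) : ‖a‖ + ‖b‖ ≤ ‖a + b‖ + 2 * min ‖a‖ ‖b‖ := by
  have h1 := norm_sub_norm_le a (-b)
  have h2 := norm_sub_norm_le b (-a)
  rw [norm_neg, sub_neg_eq_add] at h1 h2
  rw [add_comm b a] at h2
  rcases min_cases ‖a‖ ‖b‖ with ⟨h, _⟩ | ⟨h, _⟩ <;> rw [h] <;> linarith

/-- The integral of the minimum measures the overlap of the two kernels and vanishes in the limit.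
It is kept on the larger side, which avoids subtraction of extended reals. -/
theorem le_bergmanProjNorm {n N : ℕ} {α : ℝ} (hn : 1 ≤ n) (hN : 1 ≤ N) (hα : -1 < α) :
    ENNReal.ofReal (momentConst (n + 1 + α) (N - 1)) +
      ENNReal.ofReal (seminormConst (n + 1 + α) N) ≤ bergmanProjNorm n N α := by
  have hx := one_lt_dim_add_one_add hn hα
  have hlim1 := (tendsto_lintegral_derivKernel hx hN).const_add
    (ENNReal.ofReal (momentConst (n + 1 + α) (N - 1)))
  have hlim2 := (ENNReal.Tendsto.const_mul (a := 2) (tendsto_lintegral_min_derivKernel hx hN (N - 1))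
    (Or.inr ENNReal.ofNat_ne_top)).const_add (bergmanProjNorm n N α)
  rw [mul_zero, add_zero] at hlim2
  refine le_of_tendsto_of_tendsto hlim1 hlim2 ?_
  filter_upwards [Ioo_mem_nhdsLT one_pos] with r hr
  have hA : 0 < 1 - r ^ 2 := by nlinarith [hr.1, hr.2]
  have hm0 := measurable_derivKernel (n + 1 + α) (N - 1) 0
  have hmr := measurable_derivKernel (n + 1 + α) N r
  refine le_trans ?_ (add_le_add_left
    (lintegral_add_derivKernel_le_bergmanProjNorm (N := N) hn hα hr.1.le hr.2) _)
  rw [← lintegral_derivKernel_zero hx, ← lintegral_const_mul _ (by fun_prop),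
    ← lintegral_add_left (by fun_prop), ← lintegral_add_left (by fun_prop)]
  refine lintegral_mono fun ζ => ?_
  have h := norm_add_norm_le_norm_add_add_min (derivKernel (n + 1 + α) (N - 1) 0 ζ)
    (((1 - r ^ 2) ^ N : ℝ) * derivKernel (n + 1 + α) N r ζ)
  have e : ‖(((1 - r ^ 2) ^ N : ℝ) : ℂ) * derivKernel (n + 1 + α) N r ζ‖ =
      (1 - r ^ 2) ^ N * ‖derivKernel (n + 1 + α) N r ζ‖ := by
    rw [norm_mul, Complex.norm_real, Real.norm_of_nonneg (by positivity)]
  rw [e] at h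
  have h2 := ENNReal.ofReal_le_ofReal h
  rw [ENNReal.ofReal_add (by positivity) (by positivity),
    ENNReal.ofReal_add (by positivity) (by positivity), ENNReal.ofReal_mul zero_le_two,
    ENNReal.ofReal_ofNat] at h2
  exact h2

end BergmanBloch

theorem theorem5 (n N : ℕ) (hn : 1 ≤ n) (hN : 1 ≤ N) (α : ℝ) (hα : -1 < α) :
    (∀ g : BergmanBloch.LInfty n, BergmanBloch.IsBloch (BergmanBloch.bergmanProj n α g)) ∧
    BergmanBloch.bergmanProjNorm n N α =
      ENNReal.ofReal
        (Real.Gamma (n + N + α) * Real.Gamma ((1 + N) / 2) / Real.Gamma ((1 + N) / 2 + α + n) +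
          Real.Gamma (n + N + α + 1) * Real.Gamma N /
            Real.Gamma (N / 2 + (n + α + 1) / 2) ^ 2) := by
  have hx := BergmanBloch.one_lt_dim_add_one_add hn hα
  have hN0 : (1 : ℝ) ≤ N := by exact_mod_cast hN
  refine ⟨fun g => BergmanBloch.isBloch_bergmanProj hn hα g, ?_⟩
  -- Here `N - 1` is natural subtraction; `1 ≤ N` lets it be cast to the real difference.
  have h1 : BergmanBloch.momentConst (n + 1 + α) (N - 1) = Real.Gamma (n + N + α) * Real.Gamma ((1 + N) / 2) /
      Real.Gamma ((1 + N) / 2 + α + n) := by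
    rw [BergmanBloch.momentConst, Nat.cast_sub hN, Nat.cast_one]
    ring_nf
  have h2 : BergmanBloch.seminormConst (n + 1 + α) N = Real.Gamma (n + N + α + 1) * Real.Gamma N /
      Real.Gamma (N / 2 + (n + α + 1) / 2) ^ 2 := by
    rw [BergmanBloch.seminormConst]
    ring_nf
  have hG : ∀ t : ℝ, 0 < t → 0 ≤ Real.Gamma t := fun t ht => (Real.Gamma_pos_of_pos ht).le
  have hnn1 : 0 ≤ BergmanBloch.momentConst (n + 1 + α) (N - 1) := by
    have := hG (n + 1 + α + (N - 1 : ℕ)) (by positivity)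
    have := hG ((N - 1 : ℕ) / 2 + 1) (by positivity)
    have := hG (n + 1 + α + (N - 1 : ℕ) / 2) (by positivity)
    unfold BergmanBloch.momentConst
    positivity
  have hnn2 : 0 ≤ BergmanBloch.seminormConst (n + 1 + α) N := by
    have := hG (n + 1 + α + N) (by positivity)
    have := hG N (by positivity)
    unfold BergmanBloch.seminormConst
    positivity
  rw [← h1, ← h2, ENNReal.ofReal_add hnn1 hnn2]
  exact le_antisymm (iSup₂_le fun g hg => BergmanBloch.blochNorm_bergmanProj_le hn hN hα hg)
    (BergmanBloch.le_bergmanProjNorm hn hN hα)
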